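/- Let $d\ge 2$, $\alpha\in(0,2)$, $2\le k\le d$ and $p\in(0,\alpha)$. Put $D_k=\mathbb R^d\setminus\{y\in\mathbb R^d: y_{d-k+1}=\dots=y_d=0\}$, let $\delta_{D_k}(y)$ be the distance from $y$ to $\mathbb R^d\setminus D_k$, and let $$\mathcal A(n,-\alpha)=\frac{\alpha\,2^{\alpha-1}\,\Gamma\!\left(\frac{n+\alpha}{2}\right)}{\pi^{n/2}\,\Gamma\!\left(1-\frac{\alpha}{2}\right)}.$$ Define $$W(d,k)=\int_{\mathbb R^{d-k}}\frac{du}{(1+|u|^2)^{(d+\alpha)/2}}\qquad(W(d,d)=1),$$ $$H(s,k)=2\pi\,\frac{\pi^{(k-3)/2}}{\Gamma\left(\frac{k-1}{2}\right)}\int_0^\pi \sin^{k-2}\theta\;\frac{\left(\sqrt{s^2-\sin^2\theta}+\cos\theta\right)^{1+\alpha}}{\sqrt{s^2-\sin^2\theta}}\,d\theta\qquad(s>1),$$ $$\widetilde C(\alpha,k,p)=\mathcal A(k,-\alpha)\int_1^\infty (s^p-1)\left(1-s^{-k+\alpha-p}\right)s\,(s^2-1)^{-1-\alpha}H(s,k)\,ds,$$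 $$C(k,p)=\frac{\mathcal A(d,-\alpha)}{\mathcal A(k,-\alpha)}\,W(d,k)\,\widetilde C(\alpha,k,p).$$ Then all these integrals converge absolutely, and for every $x\in D_k$ $$\mathcal A(d,-\alpha)\ \mathrm{p.v.}\!\int_{D_k}\frac{\delta_{D_k}(y)^p-\delta_{D_k}(x)^p}{|y-x|^{d+\alpha}}\,dy-C(k,p)\,\delta_{D_k}(x)^{p-\alpha}=0,$$ where the principal value is the limit as $\varepsilon\downarrow0$ of the (absolutely convergent) integrals over $D_k\cap\{|y-x|>\varepsilon\}$, and this limit exists. -/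

import Mathlib

open MeasureTheory Filter Topology

noncomputable section

namespace StableHarmonic

/-- The subspace `{y : y_{d-k+1} = ⋯ = y_d = 0}` of `ℝ^d` (the last `k` coordinates vanish).
The 1-based coordinate number `i + 1` is at least `d - k + 1` exactly when `d ≤ i + k`. -/
def flat (d k : ℕ) : Set (EuclideanSpace ℝ (Fin d)) :=
  {y | ∀ i : Fin d, d ≤ (i : ℕ) + k → y i = 0}

/-- The open set `D_k = ℝ^d \ {y_{d-k+1} = ⋯ = y_d = 0}`. -/
def domain (d k : ℕ) : Set (EuclideanSpace ℝ (Fin d)) := (flat d k)ᶜ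

/-- The distance from `y` to the complement of `D_k`. -/
def delta (d k : ℕ) (y : EuclideanSpace ℝ (Fin d)) : ℝ :=
  Metric.infDist y (domain d k)ᶜ

/-- The principal value at `x` of `∫_D f(y) dy` exists and equals `L`: the integral over
`D \ B(x, ε)` converges absolutely for each `ε > 0`, and tends to `L` as `ε ↓ 0`. -/
def HasPV {d : ℕ} (D : Set (EuclideanSpace ℝ (Fin d))) (f : EuclideanSpace ℝ (Fin d) → ℝ)
    (x : EuclideanSpace ℝ (Fin d)) (L : ℝ) : Prop :=
  (∀ ε : ℝ, 0 < ε → IntegrableOn f (D ∩ {y | ε < ‖y - x‖})) ∧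
    Tendsto (fun ε : ℝ => ∫ y in D ∩ {y | ε < ‖y - x‖}, f y) (𝓝[>] 0) (𝓝 L)

/-- The usual normalizing constant `𝒜(n, -α)` of the fractional Laplacian on `ℝ^n`. -/
def normA (n : ℕ) (α : ℝ) : ℝ :=
  α * (2 : ℝ) ^ (α - 1) * Real.pi ^ (-(n : ℝ) / 2) * Real.Gamma (((n : ℝ) + α) / 2) /
    Real.Gamma (1 - α / 2)

/-- The integrand of `W(d, k)`. -/
def integrandW (d k : ℕ) (α : ℝ) (u : EuclideanSpace ℝ (Fin (d - k))) : ℝ :=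
  1 / Real.sqrt (1 + ‖u‖ ^ 2) ^ ((d : ℝ) + α)

/-- `W(d, k)`, an integral over `ℝ^{d-k}`. -/
def constW (d k : ℕ) (α : ℝ) : ℝ :=
  ∫ u : EuclideanSpace ℝ (Fin (d - k)), integrandW d k α u

/-- The integrand of `H(s, k)`. -/
def integrandH (k : ℕ) (α s θ : ℝ) : ℝ :=
  Real.sin θ ^ (k - 2) *
    ((Real.sqrt (s ^ 2 - Real.sin θ ^ 2) + Real.cos θ) ^ (1 + α) /
      Real.sqrt (s ^ 2 - Real.sin θ ^ 2))

/-- `H(s, k)`. -/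
def funH (k : ℕ) (α s : ℝ) : ℝ :=
  2 * Real.pi * (Real.pi ^ (((k : ℝ) - 3) / 2) / Real.Gamma (((k : ℝ) - 1) / 2)) *
    ∫ θ in (0 : ℝ)..Real.pi, integrandH k α s θ

/-- The integrand of `C̃(α, k, p)`. -/
def integrandC (k : ℕ) (α p s : ℝ) : ℝ :=
  (s ^ p - 1) * (1 - s ^ (-(k : ℝ) + α - p)) * s * (s ^ 2 - 1) ^ (-1 - α) * funH k α s

/-- `C̃(α, k, p)`. -/
def constCtilde (k : ℕ) (α p : ℝ) : ℝ :=
  normA k α * ∫ s in Set.Ioi (1 : ℝ), integrandC k α p s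

/-- `C(k, p) = C(d, k, p)`. -/
def constC (d k : ℕ) (α p : ℝ) : ℝ :=
  normA d α / normA k α * constW d k α * constCtilde k α p

end StableHarmonic

end

set_option linter.unusedSectionVars false

noncomputable section

namespace StableHarmonic

/-! ### Integration over `U × V` and a Kelvin-type inversion fixing the point `x`. -/

section Decomposition

variable {U V : Type*}
  [NormedAddCommGroup U] [InnerProductSpace ℝ U] [MeasurableSpace U] [BorelSpace U]
  [FiniteDimensional ℝ U]
  [NormedAddCommGroup V] [InnerProductSpace ℝ V] [MeasurableSpace V] [BorelSpace V]
  [FiniteDimensional ℝ V]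

/-! Split `ℝ^d` orthogonally as `U × V`, with `U` the flat and `dim V = k`; then the distance to the
complement of `D_k` is `‖v‖`. Put `a = ‖x.snd‖`. The integrand `(‖v‖^p - a^p) ‖w - x‖^(-(d+α))` is
negative for `‖v‖ < a` and positive for `‖v‖ > a`. These regions are exchanged by `kelvin`, which
inverts `v` in the sphere of radius `a` and dilates `u` about `x.fst` by `a/‖v‖`. It multiplies the
distance to `x` by exactly `a/‖v‖` (`norm_kelvin_sub`), so it carries the inner contribution to
minus the outer integral of `reflectedKernel`, the original kernel times `(‖v‖/a)^(-k+α-p)`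
(`kelvin_kernel_eq`, `lintegral_inner_eq`).

What survives is the nonnegative `residualKernel`, plus an error: the map does not preserve the
truncation `ε < ‖w - x‖`, and the two truncations differ on a thin `shell`. There the kernel is
`O(ε^(1-d-α))` and the volume is `O(ε^(d+1))`, so the error is `O(ε^(2-α))`
(`tendsto_lintegral_shell`).

The residual integral is evaluated in `lintegral_main`. Integrating out `u` yields `W(d,k)` and the
kernel of `ℝ^k`. Polar coordinates about `x.snd`, with the radius replaced by `s = ‖v‖/a` through
the law of cosines, then yield `H(s,k)` and the integrand of `C̃`. Nearly everything is done with
`ENNReal`-valued integrals, so Fubini and changes of variables need no prior integrability. -/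

theorem lintegral_withLp_prod (F : WithLp 2 (U × V) → ENNReal) (hF : Measurable F) :
    ∫⁻ w, F w = ∫⁻ v : V, ∫⁻ u : U, F (WithLp.toLp 2 (u, v)) := by
  have h := (WithLp.volume_preserving_toLp U V).lintegral_comp hF
  rw [← h, Measure.volume_eq_prod,
    lintegral_prod_symm' (fun z : U × V => F (WithLp.toLp 2 z))
      (hF.comp (WithLp.volume_preserving_toLp U V).measurable)]

theorem lintegral_comp_homothety (f : U → ENNReal) (hf : Measurable f) (x : U) {c : ℝ}
    (hc : 0 < c) :
    ∫⁻ u, f u = ENNReal.ofReal (c ^ Module.finrank ℝ U) * ∫⁻ u, f (x + c • (u - x)) := by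
  have h1 : ∫⁻ u, f (x + c • (u - x)) = ∫⁻ u, f (x + c • u) :=
    lintegral_sub_right_eq_self (fun u => f (x + c • u)) x
  have h2 : ∫⁻ u, f (x + c • u) =
      ∫⁻ u, f (x + u) ∂(Measure.map (c • ·) (volume : Measure U)) := by
    rw [lintegral_map (by fun_prop) (by fun_prop)]
  rw [h1, h2, Measure.map_addHaar_smul _ hc.ne', lintegral_smul_measure, smul_eq_mul, ← mul_assoc,
    ← ENNReal.ofReal_mul (by positivity), abs_of_pos (by positivity), mul_inv_cancel₀ (by positivity),
    ENNReal.ofReal_one, one_mul]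
  exact (lintegral_add_left_eq_self f x).symm

/-- The derivative of an inversion is a scaled reflection; this gives its Jacobian. -/
theorem abs_det_smul_reflection (K : Submodule ℝ V) (c : ℝ) :
    |(c • (K.reflection : V →L[ℝ] V)).det| = |c| ^ Module.finrank ℝ V := by
  have h : (c • (K.reflection : V →L[ℝ] V)).det
      = LinearMap.det (c • K.reflection.toLinearMap) := rfl
  rw [h, LinearMap.det_smul, Submodule.det_reflection, abs_mul]
  simp

theorem lintegral_ball_eq_lintegral_inversion (f : V → ENNReal) {a : ℝ} (ha : 0 < a) :
    ∫⁻ v in {v : V | 0 < ‖v‖ ∧ ‖v‖ < a}, f v =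
      ∫⁻ v in {v : V | a < ‖v‖}, ENNReal.ofReal ((a / ‖v‖) ^ (2 * Module.finrank ℝ V)) *
        f ((a / ‖v‖) ^ 2 • v) := by
  have hinv : ∀ v : V, EuclideanGeometry.inversion 0 a v = (a / ‖v‖) ^ 2 • v := by
    intro v; simp [EuclideanGeometry.inversion]
  have himg : {v : V | 0 < ‖v‖ ∧ ‖v‖ < a} =
      EuclideanGeometry.inversion (0 : V) a '' {v : V | a < ‖v‖} := by
    ext v
    simp only [Set.mem_ofPred_eq, Set.mem_image]
    constructor
    · rintro ⟨h0, h1⟩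
      refine ⟨EuclideanGeometry.inversion 0 a v, ?_, EuclideanGeometry.inversion_inversion _ ha.ne' _⟩
      have := EuclideanGeometry.dist_inversion_center (0 : V) v a
      rw [dist_zero_right, dist_zero_right] at this
      rw [this, lt_div_iff₀ h0]; nlinarith
    · rintro ⟨w, hw, rfl⟩
      have := EuclideanGeometry.dist_inversion_center (0 : V) w a
      rw [dist_zero_right, dist_zero_right] at this
      have hw0 : 0 < ‖w‖ := ha.trans hw
      rw [this]
      refine ⟨by positivity, ?_⟩
      rw [div_lt_iff₀ hw0]; nlinarith
  have hms : MeasurableSet {v : V | a < ‖v‖} := measurableSet_lt measurable_const measurable_norm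
  rw [himg, lintegral_image_eq_lintegral_abs_det_fderiv_mul volume hms
    (fun v hv => (EuclideanGeometry.hasFDerivAt_inversion
      (by rintro rfl; simp at hv; linarith : v ≠ 0)).hasFDerivWithinAt)
    (EuclideanGeometry.inversion_injective _ ha.ne').injOn]
  refine setLIntegral_congr_fun hms fun v hv => ?_
  rw [abs_det_smul_reflection, hinv, dist_zero_right, abs_of_nonneg (by positivity), pow_mul]

/-- Inversion in the second component, in the sphere of radius `a`, together with the
corresponding dilation about `x` in the first component. -/
def kelvin (x : U) (a : ℝ) (w : WithLp 2 (U × V)) : WithLp 2 (U × V) :=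
  WithLp.toLp 2 (x + (a / ‖w.snd‖) • (w.fst - x), (a / ‖w.snd‖) ^ 2 • w.snd)

theorem measurable_fst_withLp : Measurable fun w : WithLp 2 (U × V) => w.fst :=
  measurable_fst.comp (WithLp.volume_preserving_ofLp U V).measurable

theorem measurable_snd_withLp : Measurable fun w : WithLp 2 (U × V) => w.snd :=
  measurable_snd.comp (WithLp.volume_preserving_ofLp U V).measurable

theorem measurable_kelvin (x : U) (a : ℝ) :
    Measurable (kelvin x a : WithLp 2 (U × V) → WithLp 2 (U × V)) := by
  have h1 := measurable_fst_withLp (U := U) (V := V)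
  have h2 := measurable_snd_withLp (U := U) (V := V)
  unfold kelvin
  refine (WithLp.volume_preserving_toLp U V).measurable.comp ?_
  fun_prop

/-- Since `x.snd` lies on the sphere of inversion, it is fixed, and distances to it scale by
`‖x.snd‖/‖w.snd‖`. The dilation in `U` has the same factor, so the whole distance to `x` scales. -/
theorem norm_kelvin_sub (x : WithLp 2 (U × V)) (hx : x.snd ≠ 0) (w : WithLp 2 (U × V))
    (hw : w.snd ≠ 0) :
    ‖kelvin x.fst ‖x.snd‖ w - x‖ = ‖x.snd‖ / ‖w.snd‖ * ‖w - x‖ := by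
  have hv : 0 < ‖w.snd‖ := norm_pos_iff.2 hw
  have ha : 0 < ‖x.snd‖ := norm_pos_iff.2 hx
  have h1 : ‖(‖x.snd‖ / ‖w.snd‖) ^ 2 • w.snd - x.snd‖ =
      ‖x.snd‖ / ‖w.snd‖ * ‖w.snd - x.snd‖ := by
    have h := EuclideanGeometry.dist_inversion_inversion hw hx ‖x.snd‖
    have h' : EuclideanGeometry.inversion (0 : V) ‖x.snd‖ x.snd = x.snd := by
      apply EuclideanGeometry.inversion_of_mem_sphere; simp
    rw [h', dist_zero_right, dist_zero_right, dist_eq_norm, dist_eq_norm] at h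
    simp only [EuclideanGeometry.inversion, dist_zero_right, vsub_eq_sub, sub_zero, vadd_eq_add,
      add_zero] at h
    rw [h]; field_simp
  have h2 : ‖x.fst + (‖x.snd‖ / ‖w.snd‖) • (w.fst - x.fst) - x.fst‖ =
      ‖x.snd‖ / ‖w.snd‖ * ‖w.fst - x.fst‖ := by
    rw [add_sub_cancel_left, norm_smul, Real.norm_of_nonneg (by positivity)]
  rw [WithLp.prod_norm_eq_of_L2, WithLp.prod_norm_eq_of_L2]
  simp only [kelvin, WithLp.sub_fst, WithLp.sub_snd, WithLp.toLp_fst, WithLp.toLp_snd]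
  rw [h1, h2, mul_pow, mul_pow, ← mul_add, Real.sqrt_mul (by positivity), Real.sqrt_sq (by positivity)]

theorem norm_kelvin_snd (x : U) {a : ℝ} (ha : 0 < a) (w : WithLp 2 (U × V)) (hw : w.snd ≠ 0) :
    ‖(kelvin x a w).snd‖ = a ^ 2 / ‖w.snd‖ := by
  have hv : 0 < ‖w.snd‖ := norm_pos_iff.2 hw
  simp only [kelvin, WithLp.toLp_snd]
  rw [norm_smul, Real.norm_of_nonneg (by positivity)]
  field_simp

/-- For fixed `v` the map is a dilation in `u`, so by Fubini the Jacobian is the product of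
`(a/‖v‖)^(dim U)` from the dilation and `(a/‖v‖)^(2 dim V)` from the inversion. -/
theorem lintegral_kelvin [Nontrivial V] (F : WithLp 2 (U × V) → ENNReal) (hF : Measurable F)
    (x : U) {a : ℝ} (ha : 0 < a) :
    ∫⁻ w in {w | ‖w.snd‖ < a}, F w =
      ∫⁻ w in {w | a < ‖w.snd‖},
        ENNReal.ofReal ((a / ‖w.snd‖) ^ (Module.finrank ℝ U + 2 * Module.finrank ℝ V)) *
          F (kelvin x a w) := by
  have h2 := measurable_snd_withLp (U := U) (V := V)
  have hm1 : MeasurableSet {w : WithLp 2 (U × V) | ‖w.snd‖ < a} :=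
    measurableSet_lt h2.norm measurable_const
  have hm2 : MeasurableSet {w : WithLp 2 (U × V) | a < ‖w.snd‖} :=
    measurableSet_lt measurable_const h2.norm
  have hto := (WithLp.volume_preserving_toLp U V).measurable
  have hG : Measurable fun w : WithLp 2 (U × V) =>
      ENNReal.ofReal ((a / ‖w.snd‖) ^ (Module.finrank ℝ U + 2 * Module.finrank ℝ V)) *
          F (kelvin x a w) := by
    have := hF.comp (measurable_kelvin (V := V) x a)
    refine Measurable.mul ?_ this
    fun_prop
  rw [← lintegral_indicator hm1, ← lintegral_indicator hm2,
    lintegral_withLp_prod _ (hF.indicator hm1), lintegral_withLp_prod _ (hG.indicator hm2)]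
  have e1 : ∀ v : V, ∫⁻ u : U, Set.indicator {w : WithLp 2 (U × V) | ‖w.snd‖ < a} F
      (WithLp.toLp 2 (u, v)) = Set.indicator {v : V | ‖v‖ < a}
        (fun v => ∫⁻ u : U, F (WithLp.toLp 2 (u, v))) v := by
    intro v
    by_cases h : ‖v‖ < a <;> simp [Set.indicator, h]
  have e2 : ∀ v : V, ∫⁻ u : U, Set.indicator {w : WithLp 2 (U × V) | a < ‖w.snd‖} (fun w =>
      ENNReal.ofReal ((a / ‖w.snd‖) ^ (Module.finrank ℝ U + 2 * Module.finrank ℝ V)) *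
          F (kelvin x a w))
      (WithLp.toLp 2 (u, v)) = Set.indicator {v : V | a < ‖v‖}
        (fun v => ENNReal.ofReal ((a / ‖v‖) ^ (2 * Module.finrank ℝ V)) *
          ∫⁻ u : U, F (WithLp.toLp 2 (u, (a / ‖v‖) ^ 2 • v))) v := by
    intro v
    by_cases h : a < ‖v‖
    · have hv : 0 < ‖v‖ := ha.trans h
      simp only [Set.indicator, Set.mem_ofPred_eq, h, if_true, kelvin, WithLp.toLp_fst, WithLp.toLp_snd]
      rw [lintegral_comp_homothety (fun u : U => F (WithLp.toLp 2 (u, (a / ‖v‖) ^ 2 • v)))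
          (by fun_prop) x (c := a / ‖v‖) (by positivity), ← mul_assoc,
        ← ENNReal.ofReal_mul (by positivity), lintegral_const_mul _ (by fun_prop), ← pow_add, add_comm]
    · simp [Set.indicator, h]
  simp only [e1, e2]
  rw [lintegral_indicator (measurableSet_lt measurable_norm measurable_const),
    lintegral_indicator (measurableSet_lt measurable_const measurable_norm),
    ← lintegral_ball_eq_lintegral_inversion (fun v => ∫⁻ u : U, F (WithLp.toLp 2 (u, v))) ha]
  -- The inversion misses only the centre `v = 0`, a null set.
  apply setLIntegral_congr
  have : ({v : V | 0 < ‖v‖ ∧ ‖v‖ < a} : Set V) = {v : V | ‖v‖ < a} \ {0} := by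
    ext v; simp [and_comm]
  rw [this]
  exact (sdiff_null_ae_eq_self (measure_singleton _)).symm

end Decomposition

theorem _root_.Measurable.uncurry_comp {β γ : Type*} [MeasurableSpace β] [MeasurableSpace γ]
    {F : ℝ → ℝ → γ} (hF : Measurable (Function.uncurry F)) {f g : β → ℝ} (hf : Measurable f)
    (hg : Measurable g) : Measurable fun b => F (f b) (g b) :=
  hF.comp (hf.prodMk hg)

/-! ### Polar coordinates about an axis. -/

section Polar

variable {V : Type*} [NormedAddCommGroup V] [InnerProductSpace ℝ V] [MeasurableSpace V]
  [BorelSpace V] [FiniteDimensional ℝ V]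

/-- The surface measure of the unit sphere of `ℝ^n`. -/
def sphereArea (n : ℕ) : ℝ := 2 * Real.pi ^ ((n : ℝ) / 2) / Real.Gamma ((n : ℝ) / 2)

theorem sphereArea_nonneg (n : ℕ) : 0 ≤ sphereArea n := by
  unfold sphereArea
  have : 0 ≤ Real.Gamma ((n : ℝ) / 2) := Real.Gamma_nonneg_of_nonneg (by positivity)
  positivity

theorem toSphere_univ_eq_sphereArea [Nontrivial V] :
    (volume : Measure V).toSphere Set.univ =
      ENNReal.ofReal (sphereArea (Module.finrank ℝ V)) := by
  have hpos : 0 < Module.finrank ℝ V := Module.finrank_pos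
  have hpos' : (0 : ℝ) < Module.finrank ℝ V := by exact_mod_cast hpos
  rw [Measure.toSphere_apply_univ, InnerProductSpace.volume_ball, ENNReal.ofReal_one, one_pow,
    one_mul, ← ENNReal.ofReal_natCast, ← ENNReal.ofReal_mul (by positivity)]
  congr 1
  have hG := Real.Gamma_pos_of_pos (half_pos hpos')
  rw [sphereArea, Real.Gamma_add_one (by positivity), Real.sqrt_eq_rpow, ← Real.rpow_natCast,
    ← Real.rpow_mul Real.pi_pos.le]
  field_simp

theorem lintegral_comp_norm [Nontrivial V] (g : ℝ → ENNReal) (hg : Measurable g) :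
    ∫⁻ z : V, g ‖z‖ = ENNReal.ofReal (sphereArea (Module.finrank ℝ V)) *
      ∫⁻ r in Set.Ioi (0 : ℝ), ENNReal.ofReal (r ^ (Module.finrank ℝ V - 1)) * g r := by
  have h1 : ∫⁻ z : V, g ‖z‖ =
      ∫⁻ z : ({(0 : V)}ᶜ : Set V), g ‖z.1‖ ∂((volume : Measure V).comap (↑)) := by
    rw [lintegral_subtype_comap (measurableSet_singleton _).compl (fun x : V ↦ g ‖x‖),
      restrict_compl_singleton]
  have h2 := (volume : Measure V).measurePreserving_homeomorphUnitSphereProd.lintegral_comp_emb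
    (Homeomorph.measurableEmbedding _) (g ∘ Subtype.val ∘ Prod.snd)
  simp only [Function.comp_apply, homeomorphUnitSphereProd_apply_snd_coe] at h2
  rw [h1, h2, lintegral_prod _ (by fun_prop)]
  simp only [lintegral_const]
  rw [toSphere_univ_eq_sphereArea, mul_comm]
  congr 1
  rw [Measure.volumeIoiPow, lintegral_withDensity_eq_lintegral_mul _ (by fun_prop) (by fun_prop)]
  simp only [Pi.mul_apply]
  rw [lintegral_subtype_comap measurableSet_Ioi
    (fun x : ℝ ↦ ENNReal.ofReal (x ^ (Module.finrank ℝ V - 1)) * g x)]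

/-- Splitting off the line spanned by a unit vector. -/
def axisDecomposition (e : V) (he : ‖e‖ = 1) :
    V ≃ₗᵢ[ℝ] WithLp 2 (ℝ × (Submodule.span ℝ {e})ᗮ) :=
  (Submodule.orthogonalDecomposition (Submodule.span ℝ {e})).trans
    (LinearIsometryEquiv.withLpProdCongr 2 (LinearIsometryEquiv.toSpanUnitSingleton e he).symm
      (LinearIsometryEquiv.refl ℝ _))

theorem axisDecomposition_self (e : V) (he : ‖e‖ = 1) :
    axisDecomposition e he e = WithLp.toLp 2 (1, 0) := by
  rw [← LinearIsometryEquiv.eq_symm_apply]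
  simp [axisDecomposition]

theorem inner_eq_axisDecomposition_fst (e : V) (he : ‖e‖ = 1) (h : V) :
    inner ℝ e h = (axisDecomposition e he h).fst := by
  rw [← (axisDecomposition e he).inner_map_map, axisDecomposition_self, WithLp.prod_inner_apply]
  simp

/-- Cylindrical coordinates about `e` give `t = inner ℝ e h` and a radius `r > 0` with weight
`r^(n-2)`, where `n = dim V`. Planar polar coordinates `t = ρ cos θ`, `r = ρ sin θ` add a factor
`ρ`. -/
theorem lintegral_axial (hV : 2 ≤ Module.finrank ℝ V) (e : V) (he : ‖e‖ = 1)
    (F : ℝ → ℝ → ENNReal) (hF : Measurable (Function.uncurry F)) :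
    ∫⁻ h : V, F (inner ℝ e h) ‖h‖ =
      ENNReal.ofReal (sphereArea (Module.finrank ℝ V - 1)) *
        ∫⁻ θ in Set.Ioo 0 Real.pi, ∫⁻ ρ in Set.Ioi (0 : ℝ),
          ENNReal.ofReal (Real.sin θ ^ (Module.finrank ℝ V - 2) *
            ρ ^ (Module.finrank ℝ V - 1)) * F (ρ * Real.cos θ) ρ := by
  have hne : e ≠ 0 := by rintro rfl; simp at he
  have hfr : Module.finrank ℝ (Submodule.span ℝ {e})ᗮ = Module.finrank ℝ V - 1 := by
    have := Submodule.finrank_add_finrank_orthogonal (Submodule.span ℝ {e})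
    rw [finrank_span_singleton hne] at this
    omega
  have : Nontrivial (Submodule.span ℝ {e})ᗮ :=
    Module.nontrivial_of_finrank_pos (R := ℝ) (by omega)
  set n := Module.finrank ℝ V with hn
  have h1 : ∫⁻ h : V, F (inner ℝ e h) ‖h‖ =
      ∫⁻ w : WithLp 2 (ℝ × (Submodule.span ℝ {e})ᗮ), F w.fst ‖w‖ := by
    rw [← (axisDecomposition e he).measurePreserving.lintegral_comp
      (hF.uncurry_comp measurable_fst_withLp measurable_norm)]
    simp only [inner_eq_axisDecomposition_fst e he, LinearIsometryEquiv.norm_map]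
  rw [h1, lintegral_withLp_prod _ (hF.uncurry_comp measurable_fst_withLp measurable_norm)]
  simp only [WithLp.prod_norm_eq_of_L2, WithLp.toLp_fst, WithLp.toLp_snd, Real.norm_eq_abs, sq_abs]
  rw [lintegral_comp_norm (V := (Submodule.span ℝ {e})ᗮ)
    (fun r => ∫⁻ t : ℝ, F t (√(t ^ 2 + r ^ 2)))
    (hF.uncurry_comp (f := fun q : ℝ × ℝ => q.1) (g := fun q => √(q.1 ^ 2 + q.2 ^ 2))
      (by fun_prop) (by fun_prop)).lintegral_prod_left', hfr]
  congr 1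
  have h2 : ∀ r : ℝ, ENNReal.ofReal (r ^ (n - 1 - 1)) * ∫⁻ t : ℝ, F t (√(t ^ 2 + r ^ 2)) =
      ∫⁻ t : ℝ, ENNReal.ofReal (r ^ (n - 2)) * F t (√(t ^ 2 + r ^ 2)) := fun r => by
    rw [lintegral_const_mul _ (hF.uncurry_comp (by fun_prop) (by fun_prop)), Nat.sub_sub]
  simp only [h2]
  -- Extension by zero from the half-plane `r > 0` allows polar coordinates on the whole plane; the
  -- angles `θ ≤ 0` then contribute nothing.
  let G : ℝ × ℝ → ENNReal := Set.indicator {q | 0 < q.2}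
    fun q => ENNReal.ofReal (q.2 ^ (n - 2)) * F q.1 (√(q.1 ^ 2 + q.2 ^ 2))
  have hG0 : Measurable fun q : ℝ × ℝ =>
      ENNReal.ofReal (q.2 ^ (n - 2)) * F q.1 (√(q.1 ^ 2 + q.2 ^ 2)) :=
    Measurable.mul (by fun_prop) (hF.uncurry_comp (by fun_prop) (by fun_prop))
  have hset : MeasurableSet {q : ℝ × ℝ | 0 < q.2} := measurableSet_lt measurable_const measurable_snd
  have hG : Measurable G := hG0.indicator hset
  have h3 : ∫⁻ r in Set.Ioi (0 : ℝ), ∫⁻ t : ℝ,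
      ENNReal.ofReal (r ^ (n - 2)) * F t (√(t ^ 2 + r ^ 2)) = ∫⁻ q, G q := by
    rw [Measure.volume_eq_prod, lintegral_prod_symm' _ hG, ← lintegral_indicator measurableSet_Ioi]
    refine lintegral_congr fun r => ?_
    by_cases hr : 0 < r <;> simp [G, Set.indicator, hr]
  rw [h3, ← lintegral_comp_polarCoord_symm, polarCoord_target, Measure.volume_eq_prod,
    setLIntegral_prod_symm]
  swap
  · refine Measurable.aemeasurable (Measurable.mul (by fun_prop) ?_)
    refine hG.comp ?_
    change Measurable fun p : ℝ × ℝ => (p.1 * Real.cos p.2, p.1 * Real.sin p.2)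
    fun_prop
  rw [← lintegral_indicator measurableSet_Ioo, ← lintegral_indicator measurableSet_Ioo]
  refine lintegral_congr fun θ => ?_
  by_cases hθ : θ ∈ Set.Ioo 0 Real.pi
  · have hs := Real.sin_pos_of_pos_of_lt_pi hθ.1 hθ.2
    rw [Set.indicator_of_mem hθ,
      Set.indicator_of_mem (show θ ∈ Set.Ioo (-Real.pi) Real.pi from
        ⟨by linarith [hθ.1, Real.pi_pos], hθ.2⟩)]
    refine setLIntegral_congr_fun measurableSet_Ioi fun ρ hρ => ?_
    have hρ' : 0 < ρ := hρ
    simp only [polarCoord_symm_apply, G, Set.indicator, Set.mem_ofPred_eq, mul_pos hρ' hs, if_true]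
    have hsq : √((ρ * Real.cos θ) ^ 2 + (ρ * Real.sin θ) ^ 2) = ρ := by
      rw [mul_pow, mul_pow, ← mul_add, Real.cos_sq_add_sin_sq, mul_one, Real.sqrt_sq hρ'.le]
    rw [hsq, smul_eq_mul, ← mul_assoc, ← ENNReal.ofReal_mul hρ'.le]
    congr 2
    have : n - 1 = (n - 2) + 1 := by omega
    rw [this, pow_succ, mul_pow]; ring
  · rw [Set.indicator_of_notMem hθ]
    by_cases hθ' : θ ∈ Set.Ioo (-Real.pi) Real.pi
    · rw [Set.indicator_of_mem hθ']
      refine (setLIntegral_congr_fun measurableSet_Ioi fun ρ hρ => ?_).trans lintegral_zero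
      have hρ' : 0 < ρ := hρ
      have hθ0 : θ ≤ 0 := by
        by_contra! h; exact hθ ⟨h, hθ'.2⟩
      have hs := Real.sin_nonpos_of_nonpos_of_neg_pi_le hθ0 hθ'.1.le
      have : ¬ 0 < ρ * Real.sin θ := by
        rw [not_lt]; exact mul_nonpos_of_nonneg_of_nonpos hρ'.le hs
      simp [polarCoord_symm_apply, G, this]
    · rw [Set.indicator_of_notMem hθ']

end Polar

/-! ### The law-of-cosines substitution. -/

theorem sin_sq_le_of_one_lt {s θ : ℝ} (hs : 1 < s) : 0 < s ^ 2 - Real.sin θ ^ 2 := by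
  nlinarith [Real.sin_sq_le_one θ]

theorem abs_cos_lt_sqrt {s θ : ℝ} (hs : 1 < s) : |Real.cos θ| < √(s ^ 2 - Real.sin θ ^ 2) := by
  rw [← Real.sqrt_sq_eq_abs]
  apply Real.sqrt_lt_sqrt (sq_nonneg _)
  nlinarith [Real.sin_sq_add_cos_sq θ]

/-- For a fixed angle, substitution of the distance `a s` to the origin for the distance `ρ`
to a point at distance `a` from the origin. -/
theorem lintegral_distance_substitution (θ : ℝ) {a : ℝ} (ha : 0 < a) (g : ℝ → ℝ → ENNReal) :
    ∫⁻ ρ in {ρ : ℝ | 0 < ρ ∧ a < √(a ^ 2 + ρ ^ 2 + 2 * a * (ρ * Real.cos θ))},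
        g (√(a ^ 2 + ρ ^ 2 + 2 * a * (ρ * Real.cos θ))) ρ =
      ∫⁻ s in Set.Ioi (1 : ℝ), ENNReal.ofReal (a * s / √(s ^ 2 - Real.sin θ ^ 2)) *
        g (a * s) (a * (√(s ^ 2 - Real.sin θ ^ 2) - Real.cos θ)) := by
  -- `r s` is the positive root `ρ` of `ρ² + 2aρ cos θ + a² = (a s)²`.
  set r : ℝ → ℝ := fun s => a * (√(s ^ 2 - Real.sin θ ^ 2) - Real.cos θ) with hr
  have hkey : ∀ s, 1 < s → a ^ 2 + r s ^ 2 + 2 * a * (r s * Real.cos θ) = (a * s) ^ 2 := by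
    intro s hs
    have h1 := Real.sq_sqrt (sin_sq_le_of_one_lt (θ := θ) hs).le
    have h2 := Real.sin_sq_add_cos_sq θ
    simp only [hr]
    linear_combination a ^ 2 * h1 + a ^ 2 * (-1) * h2
  have hkey' : ∀ s, 1 < s → √(a ^ 2 + r s ^ 2 + 2 * a * (r s * Real.cos θ)) = a * s := by
    intro s hs
    rw [hkey s hs, Real.sqrt_sq (by nlinarith)]
  have himg : {ρ : ℝ | 0 < ρ ∧ a < √(a ^ 2 + ρ ^ 2 + 2 * a * (ρ * Real.cos θ))} =
      r '' Set.Ioi 1 := by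
    ext ρ
    simp only [Set.mem_ofPred_eq, Set.mem_image, Set.mem_Ioi]
    constructor
    · rintro ⟨h0, h1⟩
      have hnn : 0 ≤ a ^ 2 + ρ ^ 2 + 2 * a * (ρ * Real.cos θ) := by
        by_contra! h
        rw [Real.sqrt_eq_zero_of_nonpos h.le] at h1; linarith
      refine ⟨√(a ^ 2 + ρ ^ 2 + 2 * a * (ρ * Real.cos θ)) / a, by rwa [one_lt_div ha], ?_⟩
      have h2 := Real.sin_sq_add_cos_sq θ
      have h3 : a ^ 2 < a ^ 2 + ρ ^ 2 + 2 * a * (ρ * Real.cos θ) := by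
        rwa [Real.lt_sqrt ha.le] at h1
      have h4 : (√(a ^ 2 + ρ ^ 2 + 2 * a * (ρ * Real.cos θ)) / a) ^ 2 - Real.sin θ ^ 2 =
          (ρ / a + Real.cos θ) ^ 2 := by
        rw [div_pow, Real.sq_sqrt hnn]
        field_simp
        linear_combination -a ^ 2 * h2
      -- This selects the branch of the square root: `ρ > 0` and `ρ (ρ + 2a cos θ) > 0` force `ρ + a
      -- cos θ > 0`.
      have h5 : 0 ≤ ρ / a + Real.cos θ := by
        have : 0 < ρ * (ρ + 2 * a * Real.cos θ) := by nlinarith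
        have h6 := (pos_iff_pos_of_mul_pos this).1 h0
        have : 0 < ρ + a * Real.cos θ := by nlinarith
        have h7 : ρ / a + Real.cos θ = (ρ + a * Real.cos θ) / a := by field_simp
        rw [h7]; positivity
      simp only [hr]
      rw [h4, Real.sqrt_sq h5]
      field_simp
      ring
    · rintro ⟨s, hs, rfl⟩
      refine ⟨?_, ?_⟩
      · have := (le_abs_self _).trans_lt (abs_cos_lt_sqrt (θ := θ) hs)
        simp only [hr]
        exact mul_pos ha (by linarith)
      · rw [hkey' s hs]; nlinarith
  have hder : ∀ s ∈ Set.Ioi (1 : ℝ),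
      HasDerivWithinAt r (a * s / √(s ^ 2 - Real.sin θ ^ 2)) (Set.Ioi 1) s := by
    intro s hs
    have h0 := sin_sq_le_of_one_lt (θ := θ) hs
    have h1 : HasDerivAt (fun s : ℝ => s ^ 2 - Real.sin θ ^ 2) (2 * s) s := by
      simpa using (hasDerivAt_pow 2 s).sub_const (Real.sin θ ^ 2)
    have h2 := ((h1.sqrt h0.ne').sub_const (Real.cos θ)).const_mul a
    rw [mul_div_mul_left _ _ two_ne_zero, ← mul_div_assoc] at h2
    exact h2.hasDerivWithinAt
  have hinj : Set.InjOn r (Set.Ioi 1) := by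
    intro s hs t ht hst
    have h1 := hkey' s hs
    have h2 := hkey' t ht
    rw [← hst, h1] at h2
    exact mul_left_cancel₀ ha.ne' h2
  rw [himg, lintegral_image_eq_lintegral_abs_deriv_mul measurableSet_Ioi hder hinj
    (fun ρ => g (√(a ^ 2 + ρ ^ 2 + 2 * a * (ρ * Real.cos θ))) ρ)]
  refine setLIntegral_congr_fun measurableSet_Ioi fun s hs => ?_
  have hs' : 0 < s := zero_lt_one.trans hs
  rw [hkey' s hs, abs_of_nonneg (by positivity)]

/-! ### Bounds for `H` and convergence of the integral defining `C̃`. -/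

section OneDimensional

theorem sqrt_add_cos_pos {s θ : ℝ} (hs : 1 < s) : 0 < √(s ^ 2 - Real.sin θ ^ 2) + Real.cos θ := by
  have := (neg_le_abs (Real.cos θ)).trans_lt (abs_cos_lt_sqrt (θ := θ) hs)
  linarith

theorem continuous_integrandH (k : ℕ) (α : ℝ) {s : ℝ} (hs : 1 < s) :
    Continuous (integrandH k α s) := by
  unfold integrandH
  have h1 : Continuous fun θ => √(s ^ 2 - Real.sin θ ^ 2) := by fun_prop
  refine (Real.continuous_sin.pow _).mul (Continuous.div ?_ h1 fun θ => ?_)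
  · exact (h1.add Real.continuous_cos).rpow_const fun θ => Or.inl (sqrt_add_cos_pos hs).ne'
  · exact (Real.sqrt_pos.2 (sin_sq_le_of_one_lt hs)).ne'

theorem integrandH_nonneg (k : ℕ) (α : ℝ) {s θ : ℝ} (hs : 1 < s) (hθ : θ ∈ Set.Icc 0 Real.pi) :
    0 ≤ integrandH k α s θ := by
  unfold integrandH
  have h1 := Real.sin_nonneg_of_nonneg_of_le_pi hθ.1 hθ.2
  have h2 := (sqrt_add_cos_pos (θ := θ) hs).le
  positivity

/-- With `R` the square root, `|cos θ| < R ≤ s`, so the numerator is at most `(2R)^(1+α)` and the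
division by `R` leaves the power `α`. -/
theorem integrandH_le (k : ℕ) {α : ℝ} (hα : 0 < α) {s θ : ℝ} (hs : 1 < s)
    (hθ : θ ∈ Set.Icc 0 Real.pi) : integrandH k α s θ ≤ 2 ^ (1 + α) * s ^ α := by
  have h0 := Real.sin_nonneg_of_nonneg_of_le_pi hθ.1 hθ.2
  have h1 := sqrt_add_cos_pos (θ := θ) hs
  have h2 := abs_cos_lt_sqrt (θ := θ) hs
  have h3 : 0 < √(s ^ 2 - Real.sin θ ^ 2) := (abs_nonneg _).trans_lt h2
  unfold integrandH
  set R := √(s ^ 2 - Real.sin θ ^ 2) with hR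
  have h4 : R ≤ s := by
    rw [hR, Real.sqrt_le_left (by linarith)]
    nlinarith [sq_nonneg (Real.sin θ)]
  have h5 : R + Real.cos θ ≤ 2 * R := by linarith [le_abs_self (Real.cos θ)]
  have h6 : (R + Real.cos θ) ^ (1 + α) / R ≤ 2 ^ (1 + α) * s ^ α := by
    rw [div_le_iff₀ h3]
    calc (R + Real.cos θ) ^ (1 + α) ≤ (2 * R) ^ (1 + α) :=
          Real.rpow_le_rpow h1.le h5 (by linarith)
      _ = 2 ^ (1 + α) * R ^ α * R := by
          rw [Real.mul_rpow (by norm_num) h3.le, Real.rpow_add h3 1 α, Real.rpow_one]; ring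
      _ ≤ 2 ^ (1 + α) * s ^ α * R := by gcongr
  calc Real.sin θ ^ (k - 2) * ((R + Real.cos θ) ^ (1 + α) / R)
      ≤ 1 * (2 ^ (1 + α) * s ^ α) := by
        gcongr
        exact pow_le_one₀ h0 (Real.sin_le_one θ)
    _ = _ := one_mul _

/-- The prefactor of `H` is the area of the unit sphere of `ℝ^(k-1)`, the factor produced by
`lintegral_axial`. -/
theorem funH_eq (k : ℕ) (hk : 2 ≤ k) (α s : ℝ) :
    funH k α s = sphereArea (k - 1) * ∫ θ in (0 : ℝ)..Real.pi, integrandH k α s θ := by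
  unfold funH sphereArea
  rw [Nat.cast_sub (by omega), Nat.cast_one]
  congr 1
  have : ((k : ℝ) - 1) / 2 = 1 + ((k : ℝ) - 3) / 2 := by ring
  rw [mul_div_assoc', this, Real.rpow_add Real.pi_pos, Real.rpow_one]
  ring

theorem intervalIntegral_integrandH_nonneg (k : ℕ) (α : ℝ) {s : ℝ} (hs : 1 < s) :
    0 ≤ ∫ θ in (0 : ℝ)..Real.pi, integrandH k α s θ :=
  intervalIntegral.integral_nonneg Real.pi_pos.le fun _ hθ => integrandH_nonneg k α hs hθ

theorem funH_nonneg (k : ℕ) (hk : 2 ≤ k) (α : ℝ) {s : ℝ} (hs : 1 < s) : 0 ≤ funH k α s := by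
  rw [funH_eq k hk]
  exact mul_nonneg (sphereArea_nonneg _) (intervalIntegral_integrandH_nonneg k α hs)

theorem funH_le (k : ℕ) (hk : 2 ≤ k) {α : ℝ} (hα : 0 < α) {s : ℝ} (hs : 1 < s) :
    funH k α s ≤ sphereArea (k - 1) * (Real.pi * 2 ^ (1 + α)) * s ^ α := by
  rw [funH_eq k hk, mul_assoc]
  refine mul_le_mul_of_nonneg_left ?_ (sphereArea_nonneg _)
  have := intervalIntegral.integral_mono_on Real.pi_pos.le
    ((continuous_integrandH k α hs).intervalIntegrable 0 Real.pi)
    (intervalIntegrable_const (μ := volume) (c := 2 ^ (1 + α) * s ^ α)) fun θ hθ => integrandH_le k hα hs hθ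
  rw [intervalIntegral.integral_const, sub_zero, smul_eq_mul] at this
  rwa [mul_assoc]

theorem measurable_integrandH (k : ℕ) (α : ℝ) :
    Measurable fun q : ℝ × ℝ => integrandH k α q.1 q.2 := by
  unfold integrandH
  fun_prop

theorem measurable_funH (k : ℕ) (α : ℝ) : Measurable (funH k α) := by
  unfold funH
  refine Measurable.const_mul ?_ _
  simp only [intervalIntegral.integral_of_le Real.pi_pos.le]
  exact ((measurable_integrandH k α).stronglyMeasurable.integral_prod_right').measurable

theorem measurable_integrandC (k : ℕ) (α p : ℝ) : Measurable (integrandC k α p) := by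
  have := measurable_funH k α
  unfold integrandC
  fun_prop

theorem one_sub_rpow_neg_le {s q : ℝ} (hs : 1 < s) (hq : 0 ≤ q) : 1 - s ^ (-q) ≤ q * (s - 1) := by
  have h0 : 0 < s := by linarith
  rw [Real.rpow_def_of_pos h0]
  have h1 := Real.add_one_le_exp (Real.log s * -q)
  have h2 := Real.log_le_sub_one_of_pos h0
  nlinarith

theorem rpow_sub_one_le {s p : ℝ} (hs : 1 < s) (hs2 : s ≤ 2) (hp : p < 2) :
    s ^ p - 1 ≤ 3 * (s - 1) := by
  have : s ^ p ≤ s ^ (2 : ℝ) := Real.rpow_le_rpow_of_exponent_le hs.le hp.le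
  rw [Real.rpow_two] at this
  nlinarith

theorem integrandC_nonneg (k : ℕ) (hk : 2 ≤ k) {α p s : ℝ} (hα2 : α < 2) (hp0 : 0 < p)
    (hs : 1 < s) : 0 ≤ integrandC k α p s := by
  have hk' : (2 : ℝ) ≤ k := by exact_mod_cast hk
  have h1 : 1 ≤ s ^ p := Real.one_le_rpow hs.le hp0.le
  have h2 : s ^ (-(k : ℝ) + α - p) ≤ 1 := Real.rpow_le_one_of_one_le_of_nonpos hs.le (by linarith)
  have h3 := funH_nonneg k hk α hs
  have h4 : 0 < s ^ 2 - 1 := by nlinarith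
  unfold integrandC
  have := sub_nonneg.2 h1
  have := sub_nonneg.2 h2
  positivity

/-- Both differences vanish linearly at `s = 1`, which softens `(s-1)^(-1-α)` to `(s-1)^(1-α)`,
integrable because `α < 2`. -/
theorem integrandC_le_near (k : ℕ) (hk : 2 ≤ k) {α p s : ℝ} (hα0 : 0 < α) (hα2 : α < 2)
    (hp0 : 0 < p) (hpα : p < α) (hs : 1 < s) (hs2 : s ≤ 2) :
    integrandC k α p s ≤ 3 * (k - α + p) * 2 * (sphereArea (k - 1) * (Real.pi * 2 ^ (1 + α)) *
      2 ^ α) * (s - 1) ^ (1 - α) := by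
  have hk' : (2 : ℝ) ≤ k := by exact_mod_cast hk
  have h1 : 1 ≤ s ^ p := Real.one_le_rpow hs.le hp0.le
  have h2 := one_sub_rpow_neg_le hs (q := k - α + p) (by linarith)
  have h3 := funH_nonneg k hk α hs
  have h4 : 0 < s - 1 := by linarith
  have h5 : (s ^ 2 - 1) ^ (-1 - α) ≤ (s - 1) ^ (-1 - α) :=
    Real.rpow_le_rpow_of_nonpos h4 (by nlinarith) (by linarith)
  have h6 := (funH_le k hk hα0 hs).trans (mul_le_mul_of_nonneg_left
    (Real.rpow_le_rpow (by linarith) hs2 hα0.le) (mul_nonneg (sphereArea_nonneg _) (by positivity)))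
  have h7 := rpow_sub_one_le hs hs2 (hpα.trans hα2)
  have h8 : s ^ (-(k : ℝ) + α - p) ≤ 1 := Real.rpow_le_one_of_one_le_of_nonpos hs.le (by linarith)
  rw [show -((k : ℝ) - α + p) = -(k : ℝ) + α - p by ring] at h2
  have h9 : (s - 1) ^ (1 - α) = (s - 1) * (s - 1) * (s - 1) ^ (-1 - α) := by
    rw [show 1 - α = 1 + 1 + (-1 - α) by ring, Real.rpow_add h4, Real.rpow_add h4, Real.rpow_one]
  have h10 : 0 < s ^ 2 - 1 := by nlinarith
  have h11 := sub_nonneg.2 h1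
  have h12 := sub_nonneg.2 h8
  have h13 : 0 < k - α + p := by linarith
  unfold integrandC
  calc (s ^ p - 1) * (1 - s ^ (-(k : ℝ) + α - p)) * s * (s ^ 2 - 1) ^ (-1 - α) * funH k α s
      ≤ (3 * (s - 1)) * ((k - α + p) * (s - 1)) * 2 * (s - 1) ^ (-1 - α) *
        (sphereArea (k - 1) * (Real.pi * 2 ^ (1 + α)) * 2 ^ α) := by
        gcongr
    _ = _ := by rw [h9]; ring

/-- The growth is `s^p · s · s^(-2-2α) · s^α`, integrable at infinity because `p < α`. For `s ≥ 2`
one has `s² - 1 ≥ s²/2`. -/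
theorem integrandC_le_far (k : ℕ) (hk : 2 ≤ k) {α p s : ℝ} (hα0 : 0 < α) (hα2 : α < 2)
    (hp0 : 0 < p) (hs : 2 ≤ s) :
    integrandC k α p s ≤ 2 ^ (1 + α) * (sphereArea (k - 1) * (Real.pi * 2 ^ (1 + α))) *
      s ^ (p - 1 - α) := by
  have hs1 : 1 < s := by linarith
  have hs0 : 0 < s := by linarith
  have hk' : (2 : ℝ) ≤ k := by exact_mod_cast hk
  have h3 := funH_nonneg k hk α hs1
  have h10 : 0 < s ^ 2 - 1 := by nlinarith
  have h5 : (s ^ 2 - 1) ^ (-1 - α) ≤ (s ^ 2 / 2) ^ (-1 - α) :=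
    Real.rpow_le_rpow_of_nonpos (by positivity) (by nlinarith) (by linarith)
  have h6 := funH_le k hk hα0 hs1
  have h8 : s ^ (-(k : ℝ) + α - p) ≤ 1 := Real.rpow_le_one_of_one_le_of_nonpos hs1.le (by linarith)
  have h12 := sub_nonneg.2 h8
  have h13 : 0 < s ^ (-(k : ℝ) + α - p) := by positivity
  have h14 : (s ^ 2 / 2) ^ (-1 - α) = 2 ^ (1 + α) * s ^ (-2 - 2 * α) := by
    rw [Real.div_rpow (by positivity) (by norm_num), ← Real.rpow_natCast s 2, ← Real.rpow_mul hs0.le,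
      div_eq_mul_inv, ← Real.rpow_neg (by norm_num), mul_comm]
    congr 2 <;> push_cast <;> ring
  have h15 : s ^ (p - 1 - α) = s ^ p * s * s ^ (-2 - 2 * α) * s ^ α := by
    rw [← Real.rpow_add_one hs0.ne', ← Real.rpow_add hs0, ← Real.rpow_add hs0]
    congr 1; ring
  unfold integrandC
  calc (s ^ p - 1) * (1 - s ^ (-(k : ℝ) + α - p)) * s * (s ^ 2 - 1) ^ (-1 - α) * funH k α s
      ≤ s ^ p * 1 * s * (s ^ 2 / 2) ^ (-1 - α) *
        (sphereArea (k - 1) * (Real.pi * 2 ^ (1 + α)) * s ^ α) := by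
        gcongr
        · linarith
        · linarith
    _ = _ := by rw [h14, h15]; ring

theorem integrableOn_integrandC (k : ℕ) (hk : 2 ≤ k) {α p : ℝ} (hα0 : 0 < α) (hα2 : α < 2)
    (hp0 : 0 < p) (hpα : p < α) : IntegrableOn (integrandC k α p) (Set.Ioi 1) := by
  have hmeas := measurable_integrandC k α p
  rw [← Set.Ioc_union_Ioi_eq_Ioi one_le_two]
  refine IntegrableOn.union ?_ ?_
  · have h1 : IntegrableOn (fun s : ℝ => (s - 1) ^ (1 - α)) (Set.Ioc 1 2) := by
      have h := (intervalIntegral.intervalIntegrable_rpow' (a := 0) (b := 1)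
        (r := 1 - α) (by linarith)).comp_sub_right 1
      norm_num at h
      rwa [intervalIntegrable_iff_integrableOn_Ioc_of_le one_le_two] at h
    refine (h1.const_mul (3 * (k - α + p) * 2 * (sphereArea (k - 1) *
      (Real.pi * 2 ^ (1 + α)) * 2 ^ α))).mono' hmeas.aestronglyMeasurable ?_
    refine (ae_restrict_iff' measurableSet_Ioc).2 (ae_of_all _ fun s hs => ?_)
    rw [Real.norm_of_nonneg (integrandC_nonneg k hk hα2 hp0 hs.1)]
    exact integrandC_le_near k hk hα0 hα2 hp0 hpα hs.1 hs.2
  · have h1 := integrableOn_Ioi_rpow_of_lt (a := p - 1 - α) (c := 2) (by linarith) two_pos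
    refine (h1.const_mul (2 ^ (1 + α) * (sphereArea (k - 1) *
      (Real.pi * 2 ^ (1 + α))))).mono' hmeas.aestronglyMeasurable ?_
    refine (ae_restrict_iff' measurableSet_Ioi).2 (ae_of_all _ fun s hs => ?_)
    have hs' : 2 < s := hs
    rw [Real.norm_of_nonneg (integrandC_nonneg k hk hα2 hp0 (by linarith))]
    exact integrandC_le_far k hk hα0 hα2 hp0 hs'.le

end OneDimensional

/-! ### Evaluation of the residual integral. -/

section MainIntegral

variable {U V : Type*}
  [NormedAddCommGroup U] [InnerProductSpace ℝ U] [MeasurableSpace U] [BorelSpace U]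
  [FiniteDimensional ℝ U]
  [NormedAddCommGroup V] [InnerProductSpace ℝ V] [MeasurableSpace V] [BorelSpace V]
  [FiniteDimensional ℝ V]

theorem integrandW_eq_rpow (d k : ℕ) (α : ℝ) (u : EuclideanSpace ℝ (Fin (d - k))) :
    integrandW d k α u = (1 + ‖u‖ ^ 2) ^ (-((d : ℝ) + α) / 2) := by
  unfold integrandW
  rw [Real.sqrt_eq_rpow, ← Real.rpow_mul (by positivity), one_div, ← Real.rpow_neg (by positivity)]
  congr 1; ring

theorem integrable_integrandW (d k : ℕ) {α : ℝ} (hα : 0 < α) :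
    Integrable (integrandW d k α) := by
  have h : ((Module.finrank ℝ (EuclideanSpace ℝ (Fin (d - k))) : ℕ) : ℝ) < (d : ℝ) + α := by
    rw [finrank_euclideanSpace_fin]
    have : ((d - k : ℕ) : ℝ) ≤ d := by exact_mod_cast Nat.sub_le d k
    linarith
  exact (integrable_rpow_neg_one_add_norm_sq h).congr
    (ae_of_all _ fun u => (integrandW_eq_rpow d k α u).symm)

theorem constW_nonneg (d k : ℕ) (α : ℝ) : 0 ≤ constW d k α :=
  integral_nonneg fun u => by unfold integrandW; positivity

theorem lintegral_integrandW (d k : ℕ) {α : ℝ} (hα : 0 < α) (hU : Module.finrank ℝ U = d - k) :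
    ∫⁻ u : U, ENNReal.ofReal ((1 + ‖u‖ ^ 2) ^ (-((d : ℝ) + α) / 2)) =
      ENNReal.ofReal (constW d k α) := by
  let J := ((stdOrthonormalBasis ℝ U).reindex (finCongr hU)).repr
  rw [constW, ofReal_integral_eq_lintegral_ofReal (integrable_integrandW d k hα)
    (ae_of_all _ fun u => by unfold integrandW; positivity)]
  simp only [integrandW_eq_rpow]
  rw [← J.measurePreserving.lintegral_comp (by fun_prop)]
  simp only [LinearIsometryEquiv.norm_map]

/-- Rescaling `u` about `x` by `r` extracts `r^(d-k) · r^(-(d+α)) = r^(-(k+α))`. -/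
theorem lintegral_kernel_fst (d k : ℕ) (hkd : k ≤ d) {α : ℝ} (hα : 0 < α)
    (hU : Module.finrank ℝ U = d - k) (x : U) {r : ℝ} (hr : 0 < r) :
    ∫⁻ u : U, ENNReal.ofReal (√(‖u - x‖ ^ 2 + r ^ 2) ^ (-((d : ℝ) + α))) =
      ENNReal.ofReal (constW d k α) * ENNReal.ofReal (r ^ (-((k : ℝ) + α))) := by
  have h1 : ∀ u : U, √(‖x + r • (u - x) - x‖ ^ 2 + r ^ 2) ^ (-((d : ℝ) + α)) =
      r ^ (-((d : ℝ) + α)) * (1 + ‖u - x‖ ^ 2) ^ (-((d : ℝ) + α) / 2) := by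
    intro u
    rw [add_sub_cancel_left, norm_smul, Real.norm_of_nonneg hr.le,
      show (r * ‖u - x‖) ^ 2 + r ^ 2 = r ^ 2 * (1 + ‖u - x‖ ^ 2) by ring,
      Real.sqrt_mul (by positivity), Real.sqrt_sq hr.le,
      Real.mul_rpow hr.le (by positivity), Real.sqrt_eq_rpow, ← Real.rpow_mul (by positivity)]
    congr 2; ring
  rw [lintegral_comp_homothety _ (by fun_prop) x hr]
  simp only [h1, ENNReal.ofReal_mul (Real.rpow_nonneg hr.le _)]
  rw [lintegral_const_mul _ (by fun_prop),
    lintegral_sub_right_eq_self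
      (fun u : U => ENNReal.ofReal ((1 + ‖u‖ ^ 2) ^ (-((d : ℝ) + α) / 2))) x,
    lintegral_integrandW d k hα hU, ← mul_assoc, ← ENNReal.ofReal_mul (by positivity), mul_comm]
  congr 2
  rw [hU, ← Real.rpow_natCast, ← Real.rpow_add hr, Nat.cast_sub hkd]
  congr 1; ring

theorem lintegral_reduce_fst (d k : ℕ) (hkd : k ≤ d) {α : ℝ} (hα : 0 < α)
    (hU : Module.finrank ℝ U = d - k) (x : WithLp 2 (U × V)) (g : ℝ → ENNReal)
    (hg : Measurable g) :
    ∫⁻ w in {w : WithLp 2 (U × V) | ‖x.snd‖ < ‖w.snd‖},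
        g ‖w.snd‖ * ENNReal.ofReal (‖w - x‖ ^ (-((d : ℝ) + α))) =
      ENNReal.ofReal (constW d k α) * ∫⁻ v in {v : V | ‖x.snd‖ < ‖v‖},
        g ‖v‖ * ENNReal.ofReal (‖v - x.snd‖ ^ (-((k : ℝ) + α))) := by
  have h2 := measurable_snd_withLp (U := U) (V := V)
  have hm2 : MeasurableSet {w : WithLp 2 (U × V) | ‖x.snd‖ < ‖w.snd‖} :=
    measurableSet_lt measurable_const h2.norm
  have hm3 : MeasurableSet {v : V | ‖x.snd‖ < ‖v‖} := measurableSet_lt measurable_const measurable_norm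
  rw [← lintegral_indicator hm2, lintegral_withLp_prod _ (Measurable.indicator (by fun_prop) hm2),
    ← lintegral_const_mul _ (by fun_prop), ← lintegral_indicator hm3]
  refine lintegral_congr fun v => ?_
  by_cases hv : ‖x.snd‖ < ‖v‖
  · have hr : 0 < ‖v - x.snd‖ := norm_pos_iff.2 (sub_ne_zero.2 (by rintro rfl; simp at hv))
    simp only [Set.indicator, Set.mem_ofPred_eq, WithLp.toLp_snd, hv, if_true,
      WithLp.prod_norm_eq_of_L2, WithLp.sub_fst, WithLp.sub_snd, WithLp.toLp_fst]
    rw [lintegral_const_mul _ (by fun_prop), lintegral_kernel_fst d k hkd hα hU _ hr]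
    ring
  · simp [Set.indicator, hv]

/-- The radial powers combine to `ρ^(-1-α)`, and `(R - cos θ)(R + cos θ) = s² - 1`, with `R` the
square root, moves `R + cos θ` to the numerator. -/
theorem distance_kernel_eq {k : ℕ} (hk : 2 ≤ k) {α a s θ : ℝ} (ha : 0 < a) (hs : 1 < s) :
    a * s / √(s ^ 2 - Real.sin θ ^ 2) * (Real.sin θ ^ (k - 2) *
        ((a * (√(s ^ 2 - Real.sin θ ^ 2) - Real.cos θ)) ^ (k - 1) *
          (a * (√(s ^ 2 - Real.sin θ ^ 2) - Real.cos θ)) ^ (-((k : ℝ) + α)))) =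
      a ^ (-α) * (s * (s ^ 2 - 1) ^ (-1 - α)) * integrandH k α s θ := by
  have h0 := sin_sq_le_of_one_lt (θ := θ) hs
  have hsq := Real.sq_sqrt h0.le
  have h1 := sqrt_add_cos_pos (θ := θ) hs
  have h2 := (le_abs_self _).trans_lt (abs_cos_lt_sqrt (θ := θ) hs)
  have h3 := Real.sin_sq_add_cos_sq θ
  have hs1 : 0 < s ^ 2 - 1 := by nlinarith
  unfold integrandH
  set R := √(s ^ 2 - Real.sin θ ^ 2)
  have h4 : R - Real.cos θ = (s ^ 2 - 1) * (R + Real.cos θ)⁻¹ := by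
    field_simp
    linear_combination hsq - h3
  have h5 : 0 < a * (R - Real.cos θ) := mul_pos ha (by linarith)
  rw [← Real.rpow_natCast (a * (R - Real.cos θ)), ← Real.rpow_add h5, Nat.cast_sub (by omega),
    show ((k : ℝ) - (1 : ℕ)) + -((k : ℝ) + α) = -1 - α by push_cast; ring,
    Real.mul_rpow ha.le (by linarith), h4, Real.mul_rpow hs1.le (by positivity),
    Real.inv_rpow h1.le, ← Real.rpow_neg h1.le, show -(-1 - α) = 1 + α by ring,
    show a ^ (-α) = a * a ^ (-1 - α) by
      rw [show -α = 1 + (-1 - α) by ring, Real.rpow_add ha, Real.rpow_one]]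
  ring

theorem lintegral_integrandH (k : ℕ) (hk : 2 ≤ k) (α : ℝ) (h : ℝ → ENNReal) (hh : Measurable h) :
    ENNReal.ofReal (sphereArea (k - 1)) * ∫⁻ θ in Set.Ioo 0 Real.pi, ∫⁻ s in Set.Ioi (1 : ℝ),
        h s * ENNReal.ofReal (integrandH k α s θ) =
      ∫⁻ s in Set.Ioi (1 : ℝ), h s * ENNReal.ofReal (funH k α s) := by
  have hm : Measurable fun q : ℝ × ℝ => h q.1 * ENNReal.ofReal (integrandH k α q.1 q.2) :=
    (hh.comp measurable_fst).mul (measurable_integrandH k α).ennreal_ofReal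
  have hm' : Measurable fun q : ℝ × ℝ => h q.2 * ENNReal.ofReal (integrandH k α q.2 q.1) :=
    hm.comp measurable_swap
  rw [lintegral_lintegral_swap (f := fun θ s => h s * ENNReal.ofReal (integrandH k α s θ))
      hm'.aemeasurable, ← lintegral_const_mul _ hm.lintegral_prod_right']
  refine setLIntegral_congr_fun measurableSet_Ioi fun s hs => ?_
  have hs1 : 1 < s := hs
  have hH : ∫⁻ θ in Set.Ioo 0 Real.pi, ENNReal.ofReal (integrandH k α s θ) =
      ENNReal.ofReal (∫ θ in (0 : ℝ)..Real.pi, integrandH k α s θ) := by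
    rw [intervalIntegral.integral_of_le Real.pi_pos.le, integral_Ioc_eq_integral_Ioo,
      ofReal_integral_eq_lintegral_ofReal]
    · exact ((continuous_integrandH k α hs1).integrableOn_Icc).mono_set Set.Ioo_subset_Icc_self
    · exact (ae_restrict_iff' measurableSet_Ioo).2 (ae_of_all _ fun θ hθ =>
        integrandH_nonneg k α hs1 (Set.Ioo_subset_Icc_self hθ))
  simp only
  rw [lintegral_const_mul _ (continuous_integrandH k α hs1).measurable.ennreal_ofReal, hH,
    funH_eq k hk, mul_left_comm, ← ENNReal.ofReal_mul (sphereArea_nonneg _)]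

/-- After translation by `x`, the integrand depends only on `‖h‖` and the component of `h` along
`x`, so `lintegral_axial` applies; the radius is then exchanged for `s = ‖v‖/‖x‖`. -/
theorem lintegral_reduce_radial (k : ℕ) (hk : 2 ≤ k) {α : ℝ}
    (hV : Module.finrank ℝ V = k) (x : V) (hx : x ≠ 0) (g : ℝ → ENNReal) (hg : Measurable g) :
    ∫⁻ v in {v : V | ‖x‖ < ‖v‖}, g ‖v‖ * ENNReal.ofReal (‖v - x‖ ^ (-((k : ℝ) + α))) =
      ∫⁻ s in Set.Ioi (1 : ℝ), g (‖x‖ * s) *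
        ENNReal.ofReal (‖x‖ ^ (-α) * (s * (s ^ 2 - 1) ^ (-1 - α)) * funH k α s) := by
  set a := ‖x‖ with ha'
  have ha : 0 < a := norm_pos_iff.2 hx
  set e : V := a⁻¹ • x with he'
  have he : ‖e‖ = 1 := by rw [he', norm_smul, norm_inv, norm_norm, inv_mul_cancel₀ ha.ne']
  have hxe : x = a • e := by rw [he', smul_smul, mul_inv_cancel₀ ha.ne', one_smul]
  let Φ : ℝ → ℝ → ℝ := fun t r => √(a ^ 2 + r ^ 2 + 2 * a * t)
  let F0 : ℝ → ENNReal := Set.indicator (Set.Ioi a) g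
  have hF0 : Measurable F0 := hg.indicator measurableSet_Ioi
  have hnorm : ∀ h : V, ‖h + x‖ = Φ (inner ℝ e h) ‖h‖ := by
    intro h
    simp only [Φ]
    have hsq : a ^ 2 + ‖h‖ ^ 2 + 2 * a * inner ℝ e h = ‖h + x‖ ^ 2 := by
      rw [norm_add_sq_real, hxe, inner_smul_right, real_inner_comm, norm_smul, he,
        Real.norm_of_nonneg ha.le]
      ring
    rw [hsq, Real.sqrt_sq (norm_nonneg _)]
  have hm : MeasurableSet {v : V | a < ‖v‖} := measurableSet_lt measurable_const measurable_norm
  have h1 : ∫⁻ v in {v : V | a < ‖v‖}, g ‖v‖ * ENNReal.ofReal (‖v - x‖ ^ (-((k : ℝ) + α))) =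
      ∫⁻ h : V, F0 (Φ (inner ℝ e h) ‖h‖) * ENNReal.ofReal (‖h‖ ^ (-((k : ℝ) + α))) := by
    rw [← lintegral_indicator hm, ← lintegral_add_right_eq_self _ x]
    refine lintegral_congr fun h => ?_
    rw [← hnorm]
    by_cases hv : a < ‖h + x‖ <;> simp [Set.indicator, F0, hv]
  rw [h1, lintegral_axial (by omega) e he
    (fun t r => F0 (Φ t r) * ENNReal.ofReal (r ^ (-((k : ℝ) + α))))
    (by simp only [Function.uncurry_def, Φ]; fun_prop), hV]
  have h2 : ∀ θ ∈ Set.Ioo 0 Real.pi, ∫⁻ ρ in Set.Ioi (0 : ℝ),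
      ENNReal.ofReal (Real.sin θ ^ (k - 2) * ρ ^ (k - 1)) *
        (F0 (Φ (ρ * Real.cos θ) ρ) * ENNReal.ofReal (ρ ^ (-((k : ℝ) + α)))) =
      ∫⁻ s in Set.Ioi (1 : ℝ), g (a * s) *
        ENNReal.ofReal (a ^ (-α) * (s * (s ^ 2 - 1) ^ (-1 - α))) *
          ENNReal.ofReal (integrandH k α s θ) := by
    intro θ hθ
    have hsin := Real.sin_pos_of_pos_of_lt_pi hθ.1 hθ.2
    have h3 := lintegral_distance_substitution θ ha fun r ρ => g r *
      ENNReal.ofReal (Real.sin θ ^ (k - 2) * (ρ ^ (k - 1) * ρ ^ (-((k : ℝ) + α))))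
    have hms : MeasurableSet
        {ρ : ℝ | 0 < ρ ∧ a < √(a ^ 2 + ρ ^ 2 + 2 * a * (ρ * Real.cos θ))} := by
      have hm' : Measurable fun ρ : ℝ => √(a ^ 2 + ρ ^ 2 + 2 * a * (ρ * Real.cos θ)) := by fun_prop
      exact (measurableSet_lt measurable_const measurable_id).inter
        (measurableSet_lt measurable_const hm')
    rw [← lintegral_indicator hms] at h3
    rw [← lintegral_indicator measurableSet_Ioi]
    refine Eq.trans (lintegral_congr fun ρ => ?_) (h3.trans ?_)
    · by_cases hρ : 0 < ρ
      · by_cases hρ2 : a < √(a ^ 2 + ρ ^ 2 + 2 * a * (ρ * Real.cos θ))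
        · simp only [Set.indicator, Set.mem_Ioi, Set.mem_ofPred_eq, hρ, hρ2, if_true, F0, Φ, and_self]
          rw [mul_left_comm, ← ENNReal.ofReal_mul (by positivity), mul_assoc (Real.sin θ ^ (k - 2))]
        · simp [Set.indicator, hρ, hρ2, F0, Φ]
      · simp [Set.indicator, hρ]
    · refine setLIntegral_congr_fun measurableSet_Ioi fun s hs => ?_
      have hs0 : 0 < s := zero_lt_one.trans hs
      have hs1 : 1 < s := hs
      have hs2 : 0 < s ^ 2 - 1 := by nlinarith
      rw [mul_left_comm, ← ENNReal.ofReal_mul (by positivity), distance_kernel_eq hk ha hs,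
        ENNReal.ofReal_mul (by positivity), mul_assoc]
  rw [setLIntegral_congr_fun measurableSet_Ioo h2,
    lintegral_integrandH k hk α
    (fun s => g (a * s) * ENNReal.ofReal (a ^ (-α) * (s * (s ^ 2 - 1) ^ (-1 - α)))) (by fun_prop)]
  refine setLIntegral_congr_fun measurableSet_Ioi fun s hs => ?_
  have hs0 : 0 < s := zero_lt_one.trans hs
  have hs1 : 1 < s := hs
  have hs2 : 0 < s ^ 2 - 1 := by nlinarith
  rw [ENNReal.ofReal_mul (p := a ^ (-α) * (s * (s ^ 2 - 1) ^ (-1 - α))) (by positivity), mul_assoc]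

/-- The power `p - α` of `‖x.snd‖` collects `p` from the difference of powers and `-α` from the
scaled kernel. -/
theorem lintegral_main (d k : ℕ) (hk : 2 ≤ k) (hkd : k ≤ d) {α p : ℝ} (hα0 : 0 < α) (hα2 : α < 2)
    (hp0 : 0 < p) (hpα : p < α)
    (hU : Module.finrank ℝ U = d - k) (hV : Module.finrank ℝ V = k)
    (x : WithLp 2 (U × V)) (hx : x.snd ≠ 0) :
    ∫⁻ w in {w : WithLp 2 (U × V) | ‖x.snd‖ < ‖w.snd‖},
        ENNReal.ofReal ((‖w.snd‖ ^ p - ‖x.snd‖ ^ p) *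
          (1 - (‖w.snd‖ / ‖x.snd‖) ^ (-(k : ℝ) + α - p)) * ‖w - x‖ ^ (-((d : ℝ) + α))) =
      ENNReal.ofReal (constW d k α * (∫ s in Set.Ioi (1 : ℝ), integrandC k α p s) *
        ‖x.snd‖ ^ (p - α)) := by
  have ha : 0 < ‖x.snd‖ := norm_pos_iff.2 hx
  have h1 : ∀ w : WithLp 2 (U × V), ENNReal.ofReal ((‖w.snd‖ ^ p - ‖x.snd‖ ^ p) *
          (1 - (‖w.snd‖ / ‖x.snd‖) ^ (-(k : ℝ) + α - p)) * ‖w - x‖ ^ (-((d : ℝ) + α))) =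
      ENNReal.ofReal ((‖w.snd‖ ^ p - ‖x.snd‖ ^ p) *
          (1 - (‖w.snd‖ / ‖x.snd‖) ^ (-(k : ℝ) + α - p))) *
        ENNReal.ofReal (‖w - x‖ ^ (-((d : ℝ) + α))) := fun w => by
    rw [ENNReal.ofReal_mul' (by positivity)]
  simp only [h1]
  rw [lintegral_reduce_fst d k hkd hα0 hU x (fun r => ENNReal.ofReal ((r ^ p - ‖x.snd‖ ^ p) *
          (1 - (r / ‖x.snd‖) ^ (-(k : ℝ) + α - p)))) (by fun_prop),
    lintegral_reduce_radial k hk hV x.snd hx (fun r => ENNReal.ofReal ((r ^ p - ‖x.snd‖ ^ p) *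
          (1 - (r / ‖x.snd‖) ^ (-(k : ℝ) + α - p)))) (by fun_prop), mul_assoc,
    ENNReal.ofReal_mul (constW_nonneg d k α), mul_comm (∫ s in Set.Ioi (1 : ℝ), _),
    ENNReal.ofReal_mul (by positivity),
    ofReal_integral_eq_lintegral_ofReal (integrableOn_integrandC k hk hα0 hα2 hp0 hpα)
      ((ae_restrict_iff' measurableSet_Ioi).2 (ae_of_all _ fun s hs =>
        integrandC_nonneg k hk hα2 hp0 hs)),
    ← lintegral_const_mul _ (measurable_integrandC k α p).ennreal_ofReal]
  congr 1
  refine setLIntegral_congr_fun measurableSet_Ioi fun s hs => ?_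
  have hs0 : 0 < s := zero_lt_one.trans hs
  have hs1 : 1 < s := hs
  have hs2 : 0 < s ^ 2 - 1 := by nlinarith
  have hH := funH_nonneg k hk α hs1
  rw [← ENNReal.ofReal_mul' (by positivity), ← ENNReal.ofReal_mul (by positivity)]
  congr 1
  rw [mul_div_cancel_left₀ _ ha.ne', Real.mul_rpow ha.le hs0.le, integrandC,
    sub_eq_add_neg p α, Real.rpow_add ha]
  ring

end MainIntegral

/-! ### Cancellation under the inversion and the limit `ε ↓ 0`. -/

section PrincipalValue

variable {U V : Type*}
  [NormedAddCommGroup U] [InnerProductSpace ℝ U] [MeasurableSpace U] [BorelSpace U]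
  [FiniteDimensional ℝ U]
  [NormedAddCommGroup V] [InnerProductSpace ℝ V] [MeasurableSpace V] [BorelSpace V]
  [FiniteDimensional ℝ V]

/-- Chord bound for a convex function on `[0, 1]`, used for the volume of the shell. -/
theorem one_add_pow_le (n : ℕ) {y : ℝ} (hy0 : 0 ≤ y) (hy1 : y ≤ 1) :
    (1 + y) ^ n ≤ 1 + (2 ^ n - 1) * y := by
  induction n with
  | zero => simp
  | succ n ih =>
    have h2 : (1 : ℝ) ≤ 2 ^ n := one_le_pow₀ one_le_two
    rw [pow_succ, pow_succ]
    have h3 := mul_le_mul_of_nonneg_right ih (by linarith : 0 ≤ 1 + y)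
    have h4 : 0 ≤ (2 ^ n - 1) * (y * (1 - y)) :=
      mul_nonneg (by linarith) (mul_nonneg hy0 (by linarith))
    nlinarith

theorem norm_snd_le (w : WithLp 2 (U × V)) : ‖w.snd‖ ≤ ‖w‖ := by
  rw [WithLp.prod_norm_eq_of_L2]
  exact Real.le_sqrt_of_sq_le (by nlinarith [sq_nonneg ‖w.fst‖])

theorem norm_snd_le_add (w x : WithLp 2 (U × V)) : ‖w.snd‖ ≤ ‖x.snd‖ + ‖w - x‖ := by
  have h1 := norm_snd_le (w - x)
  have h2 : ‖w.snd‖ ≤ ‖x.snd‖ + ‖w.snd - x.snd‖ := norm_le_norm_add_norm_sub' _ _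
  rw [WithLp.sub_snd] at h1
  linarith

theorem norm_sub_pos_of_norm_snd_lt {w x : WithLp 2 (U × V)} (h : ‖x.snd‖ < ‖w.snd‖) :
    0 < ‖w - x‖ := by
  linarith [norm_snd_le_add w x]

/-- The part of the integrand that the inversion exchanges with the contribution of the
points closer to the flat than `x`. -/
def reflectedKernel (d k : ℕ) (α p : ℝ) (x w : WithLp 2 (U × V)) : ℝ :=
  (‖w.snd‖ ^ p - ‖x.snd‖ ^ p) * (‖w.snd‖ / ‖x.snd‖) ^ (-(k : ℝ) + α - p) *
    ‖w - x‖ ^ (-((d : ℝ) + α))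

/-- The integrand that remains after the cancellation. -/
def residualKernel (d k : ℕ) (α p : ℝ) (x w : WithLp 2 (U × V)) : ℝ :=
  (‖w.snd‖ ^ p - ‖x.snd‖ ^ p) * (1 - (‖w.snd‖ / ‖x.snd‖) ^ (-(k : ℝ) + α - p)) *
    ‖w - x‖ ^ (-((d : ℝ) + α))

/-- The integrand of the principal value. -/
def pvKernel (d : ℕ) (α p : ℝ) (x w : WithLp 2 (U × V)) : ℝ :=
  (‖w.snd‖ ^ p - ‖x.snd‖ ^ p) * ‖w - x‖ ^ (-((d : ℝ) + α))

theorem measurable_reflectedKernel (d k : ℕ) (α p : ℝ) (x : WithLp 2 (U × V)) :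
    Measurable (reflectedKernel d k α p x) := by
  have h2 := measurable_snd_withLp (U := U) (V := V)
  unfold reflectedKernel
  fun_prop

theorem measurable_residualKernel (d k : ℕ) (α p : ℝ) (x : WithLp 2 (U × V)) :
    Measurable (residualKernel d k α p x) := by
  have h2 := measurable_snd_withLp (U := U) (V := V)
  unfold residualKernel
  fun_prop

theorem measurable_pvKernel (d : ℕ) (α p : ℝ) (x : WithLp 2 (U × V)) :
    Measurable (pvKernel d α p x) := by
  have h2 := measurable_snd_withLp (U := U) (V := V)
  unfold pvKernel
  fun_prop

theorem measurableSet_far (ε : ℝ) (x : WithLp 2 (U × V)) : MeasurableSet {w | ε < ‖w - x‖} :=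
  measurableSet_lt measurable_const (by fun_prop)

theorem measurableSet_outer (a : ℝ) : MeasurableSet {w : WithLp 2 (U × V) | a < ‖w.snd‖} :=
  measurableSet_lt measurable_const measurable_snd_withLp.norm

theorem measurableSet_inner (a : ℝ) : MeasurableSet {w : WithLp 2 (U × V) | ‖w.snd‖ < a} :=
  measurableSet_lt measurable_snd_withLp.norm measurable_const

theorem measurableSet_farOuter (ε a : ℝ) (x : WithLp 2 (U × V)) :
    MeasurableSet {w | ε * (‖w.snd‖ / a) < ‖w - x‖} :=
  measurableSet_lt ((measurable_snd_withLp.norm.div_const a).const_mul ε) (by fun_prop)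

theorem pvKernel_eq_add (d k : ℕ) (α p : ℝ) (x w : WithLp 2 (U × V)) :
    pvKernel d α p x w = residualKernel d k α p x w + reflectedKernel d k α p x w := by
  unfold pvKernel residualKernel reflectedKernel
  ring

theorem rpow_sub_rpow_nonneg {a r p : ℝ} (ha : 0 ≤ a) (h : a ≤ r) (hp : 0 ≤ p) :
    0 ≤ r ^ p - a ^ p :=
  sub_nonneg.2 (Real.rpow_le_rpow ha h hp)

theorem reflectedKernel_nonneg (d k : ℕ) {α p : ℝ} (hp : 0 < p) {x w : WithLp 2 (U × V)}
    (h : ‖x.snd‖ < ‖w.snd‖) : 0 ≤ reflectedKernel d k α p x w := by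
  have := rpow_sub_rpow_nonneg (norm_nonneg x.snd) h.le hp.le
  unfold reflectedKernel
  positivity

theorem residualKernel_nonneg (d k : ℕ) (hk : 2 ≤ k) {α p : ℝ} (hα2 : α < 2) (hp : 0 < p)
    {x w : WithLp 2 (U × V)} (hx : x.snd ≠ 0) (h : ‖x.snd‖ < ‖w.snd‖) :
    0 ≤ residualKernel d k α p x w := by
  have hk' : (2 : ℝ) ≤ k := by exact_mod_cast hk
  have h1 := rpow_sub_rpow_nonneg (norm_nonneg x.snd) h.le hp.le
  have h2 : (‖w.snd‖ / ‖x.snd‖) ^ (-(k : ℝ) + α - p) ≤ 1 :=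
    Real.rpow_le_one_of_one_le_of_nonpos ((one_le_div (norm_pos_iff.2 hx)).2 h.le) (by linarith)
  have h3 := sub_nonneg.2 h2
  unfold residualKernel
  positivity

theorem finrank_withLp_prod :
    Module.finrank ℝ (WithLp 2 (U × V)) = Module.finrank ℝ U + Module.finrank ℝ V := by
  rw [(WithLp.linearEquiv 2 ℝ (U × V)).finrank_eq, Module.finrank_prod]

theorem integrableOn_pvKernel (d : ℕ) {α p : ℝ} (hp : 0 < p) (hpα : p < α)
    (hd : Module.finrank ℝ (WithLp 2 (U × V)) = d) (x : WithLp 2 (U × V)) {ε : ℝ} (hε : 0 < ε) :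
    IntegrableOn (pvKernel d α p x) {w | ε < ‖w - x‖} := by
  have hd' : ((Module.finrank ℝ (WithLp 2 (U × V)) : ℕ) : ℝ) < d + α - p := by rw [hd]; linarith
  have hint := (integrable_one_add_norm (μ := (volume : Measure (WithLp 2 (U × V)))) hd').comp_sub_right x
  set a := ‖x.snd‖ with ha
  have ha0 : 0 ≤ a := norm_nonneg _
  -- With `N = ‖w - x‖`, both `p`-th powers are at most `((a+1)(1+N))^p`, and `N > ε` gives `N ≥
  -- (ε/(1+ε))(1+N)`.
  refine (hint.integrableOn.const_mul
    (2 * (a + 1) ^ p * (ε / (1 + ε)) ^ (-((d : ℝ) + α)))).mono'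
      (measurable_pvKernel d α p x).aestronglyMeasurable ?_
  refine (ae_restrict_iff' (measurableSet_far ε x)).2 (ae_of_all _ fun w hw => ?_)
  have hw' : ε < ‖w - x‖ := hw
  have hv := norm_snd_le_add w x
  unfold pvKernel
  rw [← ha] at hv ⊢
  set N := ‖w - x‖
  have hN : 0 < N := hε.trans hw'
  rw [norm_mul, Real.norm_of_nonneg (Real.rpow_nonneg hN.le _), Real.norm_eq_abs]
  have h1 : |‖w.snd‖ ^ p - a ^ p| ≤ 2 * ((a + 1) ^ p * (1 + N) ^ p) := by
    have h2 : ‖w.snd‖ ^ p ≤ ((a + 1) * (1 + N)) ^ p :=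
      Real.rpow_le_rpow (norm_nonneg _) (by nlinarith) hp.le
    have h3 : a ^ p ≤ ((a + 1) * (1 + N)) ^ p := Real.rpow_le_rpow ha0 (by nlinarith) hp.le
    rw [Real.mul_rpow (by positivity) (by positivity)] at h2 h3
    have h4 : 0 ≤ ‖w.snd‖ ^ p := by positivity
    have h5 : 0 ≤ a ^ p := by positivity
    rw [abs_le]
    constructor <;> linarith
  have h2 : N ^ (-((d : ℝ) + α)) ≤ (ε / (1 + ε)) ^ (-((d : ℝ) + α)) * (1 + N) ^ (-((d : ℝ) + α)) := by
    rw [← Real.mul_rpow (by positivity) (by positivity)]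
    refine Real.rpow_le_rpow_of_nonpos (by positivity) ?_ ?_
    · rw [div_mul_eq_mul_div, div_le_iff₀ (by positivity)]
      nlinarith
    · have : (0 : ℝ) ≤ d := Nat.cast_nonneg d
      linarith
  calc |‖w.snd‖ ^ p - a ^ p| * N ^ (-((d : ℝ) + α))
      ≤ 2 * ((a + 1) ^ p * (1 + N) ^ p) *
        ((ε / (1 + ε)) ^ (-((d : ℝ) + α)) * (1 + N) ^ (-((d : ℝ) + α))) := by gcongr
    _ = _ := by
      rw [show -((d : ℝ) + α - p) = p + -((d : ℝ) + α) by ring, Real.rpow_add (by positivity)]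
      ring

/-- The difference of powers vanishes on `‖w.snd‖ = ‖x.snd‖`, which gains one power of `‖w - x‖`
over the bare kernel. -/
theorem reflectedKernel_le (d k : ℕ) (hk : 2 ≤ k) {α p : ℝ} (hα2 : α < 2) (hp : 0 < p)
    {x w : WithLp 2 (U × V)} (hx : x.snd ≠ 0) (h : ‖x.snd‖ < ‖w.snd‖) :
    reflectedKernel d k α p x w ≤ p * ‖x.snd‖ ^ (p - 1) * ‖w - x‖ ^ (1 - ((d : ℝ) + α)) := by
  have hk' : (2 : ℝ) ≤ k := by exact_mod_cast hk
  have hN := norm_sub_pos_of_norm_snd_lt h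
  have hv := norm_snd_le_add w x
  have ha : 0 < ‖x.snd‖ := norm_pos_iff.2 hx
  unfold reflectedKernel
  set a := ‖x.snd‖
  set N := ‖w - x‖
  obtain ⟨t, ht⟩ : ∃ t, ‖w.snd‖ = a * t := ⟨‖w.snd‖ / a, by field_simp⟩
  rw [ht] at h hv ⊢
  have ht1 : 1 < t := by nlinarith
  have ht0 : 0 < t := by linarith
  have h1 : (t ^ p - 1) * t ^ (-(k : ℝ) + α - p) ≤ p * (t - 1) := by
    have h2 : (t ^ p - 1) * t ^ (-(k : ℝ) + α - p) = (1 - t ^ (-p)) * t ^ (-(k : ℝ) + α) := by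
      rw [show -(k : ℝ) + α - p = -p + (-(k : ℝ) + α) by ring, Real.rpow_add ht0 (-p),
        Real.rpow_neg ht0.le]
      field_simp
    have h3 : t ^ (-(k : ℝ) + α) ≤ 1 := Real.rpow_le_one_of_one_le_of_nonpos ht1.le (by linarith)
    have h4 : t ^ (-p) ≤ 1 := Real.rpow_le_one_of_one_le_of_nonpos ht1.le (by linarith)
    rw [h2]
    exact (mul_le_of_le_one_right (by linarith) h3).trans (one_sub_rpow_neg_le ht1 hp.le)
  have h2 : p * (t - 1) ≤ p * (N / a) := by
    refine mul_le_mul_of_nonneg_left ?_ hp.le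
    rw [le_div_iff₀ ha]; nlinarith
  rw [mul_div_cancel_left₀ _ ha.ne', Real.mul_rpow ha.le ht0.le,
    show 1 - ((d : ℝ) + α) = 1 + -((d : ℝ) + α) by ring, Real.rpow_add hN, Real.rpow_one,
    Real.rpow_sub_one ha.ne']
  calc (a ^ p * t ^ p - a ^ p) * t ^ (-(k : ℝ) + α - p) * N ^ (-((d : ℝ) + α))
      = a ^ p * ((t ^ p - 1) * t ^ (-(k : ℝ) + α - p)) * N ^ (-((d : ℝ) + α)) := by ring
    _ ≤ a ^ p * (p * (N / a)) * N ^ (-((d : ℝ) + α)) := by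
      have := h1.trans h2
      gcongr
    _ = _ := by ring

/-- The region where the inverted truncation differs from the original one. -/
def shell (x : WithLp 2 (U × V)) (ε : ℝ) : Set (WithLp 2 (U × V)) :=
  {w | ε < ‖w - x‖} ∩ {w | ε * (‖w.snd‖ / ‖x.snd‖) < ‖w - x‖}ᶜ

theorem measurableSet_shell (x : WithLp 2 (U × V)) (ε : ℝ) : MeasurableSet (shell x ε) :=
  (measurableSet_far ε x).inter (measurableSet_farOuter ε ‖x.snd‖ x).compl

/-- With `a = ‖x.snd‖` and `N = ‖w - x‖`, the bound `‖w.snd‖ ≤ a + N` gives `N a ≤ ε (a + N)`. Hence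
`N ≤ 2ε`, and reinserting this gives the sharper radius. -/
theorem shell_subset {x : WithLp 2 (U × V)} (hx : x.snd ≠ 0) {ε : ℝ} (hε : 0 < ε)
    (hε2 : 2 * ε ≤ ‖x.snd‖) :
    shell x ε ⊆ Metric.closedBall x (ε * (1 + 2 * ε / ‖x.snd‖)) \ Metric.closedBall x ε := by
  rintro w ⟨h1, h2⟩
  have ha : 0 < ‖x.snd‖ := norm_pos_iff.2 hx
  simp only [Set.mem_compl_iff, Set.mem_ofPred_eq, not_lt] at h1 h2
  simp only [Set.mem_sdiff, Metric.mem_closedBall, dist_eq_norm, not_le]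
  refine ⟨?_, h1⟩
  have hv := norm_snd_le_add w x
  set a := ‖x.snd‖
  set N := ‖w - x‖
  have h3 : N * a ≤ ε * (a + N) := by
    calc N * a ≤ ε * (‖w.snd‖ / a) * a := by gcongr
      _ = ε * ‖w.snd‖ := by field_simp
      _ ≤ _ := by gcongr
  have h4 : ε * (1 + 2 * ε / a) = ε * (a + 2 * ε) / a := by field_simp
  rw [h4, le_div_iff₀ ha]
  have h5 : N ≤ 2 * ε := by nlinarith
  nlinarith

theorem measure_shell_le (d : ℕ) (hd : Module.finrank ℝ (WithLp 2 (U × V)) = d)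
    {x : WithLp 2 (U × V)} (hx : x.snd ≠ 0) {ε : ℝ} (hε : 0 < ε) (hε2 : 2 * ε ≤ ‖x.snd‖) :
    volume (shell x ε) ≤ ENNReal.ofReal (ε ^ d * ((2 ^ d - 1) * (2 * ε / ‖x.snd‖))) *
      volume (Metric.ball (0 : WithLp 2 (U × V)) 1) := by
  have ha : 0 < ‖x.snd‖ := norm_pos_iff.2 hx
  refine (measure_mono (shell_subset hx hε hε2)).trans ?_
  have hpos : 0 ≤ 2 * ε / ‖x.snd‖ := by positivity
  rw [measure_sdiff (Metric.closedBall_subset_closedBall (by nlinarith))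
    measurableSet_closedBall.nullMeasurableSet measure_closedBall_lt_top.ne,
    Measure.addHaar_closedBall _ _ (by positivity), Measure.addHaar_closedBall _ _ hε.le, hd,
    ← ENNReal.sub_mul (fun _ _ => measure_ball_lt_top.ne),
    ← ENNReal.ofReal_sub _ (by positivity)]
  gcongr
  rw [mul_pow]
  have := one_add_pow_le d hpos ((div_le_one ha).2 hε2)
  have h2 : 0 < ε ^ d := by positivity
  nlinarith

theorem tendsto_lintegral_shell (d k : ℕ) (hk : 2 ≤ k) (hkd : k ≤ d) {α p : ℝ} (hα0 : 0 < α)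
    (hα2 : α < 2) (hp : 0 < p) (hd : Module.finrank ℝ (WithLp 2 (U × V)) = d)
    {x : WithLp 2 (U × V)} (hx : x.snd ≠ 0) :
    Tendsto (fun ε : ℝ => ∫⁻ w in {w | ‖x.snd‖ < ‖w.snd‖},
      (shell x ε).indicator (fun w => ENNReal.ofReal (reflectedKernel d k α p x w)) w)
      (𝓝[>] 0) (𝓝 0) := by
  have ha : 0 < ‖x.snd‖ := norm_pos_iff.2 hx
  set a := ‖x.snd‖ with ha'
  have hd2 : (2 : ℝ) ≤ d := by exact_mod_cast hk.trans hkd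
  -- The constants of `reflectedKernel_le` and `measure_shell_le`, multiplied.
  set C : ℝ := p * a ^ (p - 1) * ((2 ^ d - 1) * (2 / a))
  have hbound : ∀ ε : ℝ, 0 < ε → 2 * ε ≤ a → ∫⁻ w in {w : WithLp 2 (U × V) | a < ‖w.snd‖},
      (shell x ε).indicator (fun w => ENNReal.ofReal (reflectedKernel d k α p x w)) w ≤
      ENNReal.ofReal (C * ε ^ (2 - α)) * volume (Metric.ball (0 : WithLp 2 (U × V)) 1) := by
    intro ε hε hε2
    calc _ ≤ ∫⁻ w in {w : WithLp 2 (U × V) | a < ‖w.snd‖}, (shell x ε).indicator (fun _ =>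
          ENNReal.ofReal (p * a ^ (p - 1) * ε ^ (1 - ((d : ℝ) + α)))) w := by
          refine setLIntegral_mono' (measurableSet_outer a) fun w hw => ?_
          refine Set.indicator_le_indicator' fun hws => ENNReal.ofReal_le_ofReal ?_
          refine (reflectedKernel_le d k hk hα2 hp hx hw).trans ?_
          have hNε : ε < ‖w - x‖ := hws.1
          refine mul_le_mul_of_nonneg_left ?_ (by positivity)
          exact Real.rpow_le_rpow_of_nonpos hε hNε.le (by linarith)
      _ ≤ ∫⁻ w, (shell x ε).indicator (fun _ =>
          ENNReal.ofReal (p * a ^ (p - 1) * ε ^ (1 - ((d : ℝ) + α)))) w :=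
          setLIntegral_le_lintegral _ _
      _ = ENNReal.ofReal (p * a ^ (p - 1) * ε ^ (1 - ((d : ℝ) + α))) * volume (shell x ε) :=
          lintegral_indicator_const (measurableSet_shell x ε) _
      _ ≤ ENNReal.ofReal (p * a ^ (p - 1) * ε ^ (1 - ((d : ℝ) + α))) *
          (ENNReal.ofReal (ε ^ d * ((2 ^ d - 1) * (2 * ε / a))) *
            volume (Metric.ball (0 : WithLp 2 (U × V)) 1)) := by
          gcongr
          exact measure_shell_le d hd hx hε hε2
      _ = _ := by
          rw [← mul_assoc, ← ENNReal.ofReal_mul (by positivity)]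
          congr 2
          have : ε ^ (2 - α) = ε ^ (1 - ((d : ℝ) + α)) * ε ^ d * ε := by
            rw [← Real.rpow_natCast, ← Real.rpow_add hε, ← Real.rpow_add_one hε.ne']
            congr 1; ring
          rw [this]
          simp only [C]
          ring
  have hlim : Tendsto (fun ε : ℝ => ENNReal.ofReal (C * ε ^ (2 - α)) *
      volume (Metric.ball (0 : WithLp 2 (U × V)) 1)) (𝓝[>] 0) (𝓝 0) := by
    have h1 : Tendsto (fun ε : ℝ => C * ε ^ (2 - α)) (𝓝[>] 0) (𝓝 0) := by
      have h := ((Real.continuousAt_rpow_const 0 (2 - α) (Or.inr (by linarith))).tendsto.const_mul C)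
      rw [Real.zero_rpow (by linarith), mul_zero] at h
      exact h.mono_left nhdsWithin_le_nhds
    have h2 := ENNReal.Tendsto.mul_const (ENNReal.tendsto_ofReal h1)
      (Or.inr (measure_ball_lt_top (μ := (volume : Measure (WithLp 2 (U × V)))) (x := 0) (r := 1)).ne)
    simpa using h2
  refine tendsto_of_tendsto_of_tendsto_of_le_of_le' tendsto_const_nhds hlim
    (Eventually.of_forall fun _ => zero_le) ?_
  have h1 : ∀ᶠ ε : ℝ in 𝓝[>] 0, ε < a / 2 :=
    nhdsWithin_le_nhds (eventually_lt_nhds (by positivity))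
  filter_upwards [h1, self_mem_nhdsWithin] with ε h2 h3
  exact hbound ε h3 (by linarith)

theorem tendsto_lintegral_residual (d k : ℕ) (hk : 2 ≤ k) (hkd : k ≤ d) {α p : ℝ} (hα0 : 0 < α)
    (hα2 : α < 2) (hp0 : 0 < p) (hpα : p < α)
    (hU : Module.finrank ℝ U = d - k) (hV : Module.finrank ℝ V = k)
    {x : WithLp 2 (U × V)} (hx : x.snd ≠ 0) :
    Tendsto (fun ε : ℝ => ∫⁻ w in {w | ‖x.snd‖ < ‖w.snd‖}, {w | ε < ‖w - x‖}.indicator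
        (fun w => ENNReal.ofReal (residualKernel d k α p x w)) w) (𝓝[>] 0)
      (𝓝 (ENNReal.ofReal (constW d k α * (∫ s in Set.Ioi (1 : ℝ), integrandC k α p s) *
        ‖x.snd‖ ^ (p - α)))) := by
  have hM := lintegral_main d k hk hkd hα0 hα2 hp0 hpα hU hV x hx
  rw [← hM]
  refine tendsto_lintegral_filter_of_dominated_convergence
    (fun w => ENNReal.ofReal (residualKernel d k α p x w))
    (Eventually.of_forall fun ε =>
      (measurable_residualKernel d k α p x).ennreal_ofReal.indicator (measurableSet_far ε x))
    (Eventually.of_forall fun ε => ae_of_all _ fun w => Set.indicator_le_self _ _ _) ?_ ?_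
  · exact (hM.trans_lt ENNReal.ofReal_lt_top).ne
  · refine (ae_restrict_iff' (measurableSet_outer _)).2 (ae_of_all _ fun w hw => ?_)
    have hN := norm_sub_pos_of_norm_snd_lt hw
    refine tendsto_const_nhds.congr' ?_
    filter_upwards [nhdsWithin_le_nhds (eventually_lt_nhds hN)] with ε hε
    rw [Set.indicator_of_mem (show w ∈ {w | ε < ‖w - x‖} from hε)]
    rfl

/-- With `t = ‖w.snd‖/‖x.snd‖`, the Jacobian gives `t^(-(d+k))`, the kernel `t^(d+α)`, and `1 -
t^(-p) = (t^p - 1) t^(-p)`; the total exponent is `-k + α - p`. -/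
theorem kelvin_kernel_eq (d k : ℕ) (hd : Module.finrank ℝ U + Module.finrank ℝ V = d)
    (hV : Module.finrank ℝ V = k) {α p : ℝ} {x w : WithLp 2 (U × V)} (hx : x.snd ≠ 0)
    (h : ‖x.snd‖ < ‖w.snd‖) :
    (‖x.snd‖ / ‖w.snd‖) ^ (Module.finrank ℝ U + 2 * Module.finrank ℝ V) *
      -pvKernel d α p x (kelvin x.fst ‖x.snd‖ w) = reflectedKernel d k α p x w := by
  have ha : 0 < ‖x.snd‖ := norm_pos_iff.2 hx
  have hw : w.snd ≠ 0 := norm_pos_iff.1 (ha.trans h)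
  have hN := norm_sub_pos_of_norm_snd_lt h
  unfold pvKernel reflectedKernel
  rw [norm_kelvin_sub x hx w hw, norm_kelvin_snd x.fst ha w hw,
    show Module.finrank ℝ U + 2 * Module.finrank ℝ V = d + k by omega]
  set a := ‖x.snd‖
  set N := ‖w - x‖
  obtain ⟨t, ht⟩ : ∃ t, ‖w.snd‖ = a * t := ⟨‖w.snd‖ / a, by field_simp⟩
  rw [ht] at h ⊢
  have ht0 : 0 < t := by
    have : 1 < t := by nlinarith
    linarith
  have h1 : a ^ 2 / (a * t) = a * t⁻¹ := by field_simp
  have h2 : a / (a * t) = t⁻¹ := by field_simp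
  rw [h1, h2, mul_div_cancel_left₀ _ ha.ne', Real.mul_rpow ha.le (by positivity),
    Real.mul_rpow ha.le ht0.le, Real.mul_rpow (by positivity) hN.le, Real.inv_rpow ht0.le,
    Real.inv_rpow ht0.le, ← Real.rpow_neg ht0.le (-_), neg_neg, inv_pow, ← Real.rpow_natCast,
    ← Real.rpow_neg ht0.le, ← Real.rpow_neg ht0.le]
  have h3 : t ^ (-(k : ℝ) + α - p) = t ^ (-((d + k : ℕ) : ℝ)) * t ^ ((d : ℝ) + α) * t ^ (-p) := by
    rw [← Real.rpow_add ht0, ← Real.rpow_add ht0]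
    congr 1; push_cast; ring
  have h4 : t ^ p * t ^ (-p) = 1 := by rw [← Real.rpow_add ht0]; simp
  rw [h3]
  linear_combination (-a ^ p * t ^ (-((d + k : ℕ) : ℝ)) * t ^ ((d : ℝ) + α) *
    N ^ (-((d : ℝ) + α))) * h4

theorem lintegral_inner_eq (d k : ℕ) (hk : 2 ≤ k)
    (hd : Module.finrank ℝ U + Module.finrank ℝ V = d)
    (hV : Module.finrank ℝ V = k) {α p : ℝ} {x : WithLp 2 (U × V)} (hx : x.snd ≠ 0) (ε : ℝ) :
    ∫⁻ w in {w | ‖w.snd‖ < ‖x.snd‖}, {w | ε < ‖w - x‖}.indicator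
        (fun w => ENNReal.ofReal (-pvKernel d α p x w)) w =
      ∫⁻ w in {w | ‖x.snd‖ < ‖w.snd‖}, {w | ε * (‖w.snd‖ / ‖x.snd‖) < ‖w - x‖}.indicator
        (fun w => ENNReal.ofReal (reflectedKernel d k α p x w)) w := by
  have : Nontrivial V := Module.nontrivial_of_finrank_pos (R := ℝ) (by omega)
  have ha : 0 < ‖x.snd‖ := norm_pos_iff.2 hx
  rw [lintegral_kelvin ({w | ε < ‖w - x‖}.indicator
    fun w => ENNReal.ofReal (-pvKernel d α p x w)) ((measurable_pvKernel d α p x).neg.ennreal_ofReal.indicator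
    (measurableSet_far ε x)) x.fst ha]
  refine setLIntegral_congr_fun (measurableSet_outer _) fun w hw => ?_
  have hw' : ‖x.snd‖ < ‖w.snd‖ := hw
  have hv : 0 < ‖w.snd‖ := ha.trans hw'
  have hiff : ε < ‖kelvin x.fst ‖x.snd‖ w - x‖ ↔ ε * (‖w.snd‖ / ‖x.snd‖) < ‖w - x‖ := by
    rw [norm_kelvin_sub x hx w (norm_pos_iff.1 hv), mul_div_assoc', div_lt_iff₀ ha,
      div_mul_eq_mul_div, lt_div_iff₀ hv, mul_comm ‖x.snd‖]
  simp only [Set.indicator, Set.mem_ofPred_eq, hiff]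
  split_ifs
  · rw [← ENNReal.ofReal_mul (by positivity), kelvin_kernel_eq d k hd hV hx hw']
  · simp

/-- The last term is the image of the inner contribution in `lintegral_inner_eq`. Its truncation is
the stricter one, as `‖w.snd‖ > ‖x.snd‖`, and the shell is what it omits. -/
theorem lintegral_outer_eq (d k : ℕ) (hk : 2 ≤ k) {α p : ℝ} (hα2 : α < 2) (hp : 0 < p)
    {x : WithLp 2 (U × V)} (hx : x.snd ≠ 0) {ε : ℝ} (hε : 0 < ε) :
    ∫⁻ w in {w | ‖x.snd‖ < ‖w.snd‖}, {w | ε < ‖w - x‖}.indicator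
        (fun w => ENNReal.ofReal (pvKernel d α p x w)) w =
      (∫⁻ w in {w | ‖x.snd‖ < ‖w.snd‖}, {w | ε < ‖w - x‖}.indicator
        (fun w => ENNReal.ofReal (residualKernel d k α p x w)) w) +
      (∫⁻ w in {w | ‖x.snd‖ < ‖w.snd‖},
        (shell x ε).indicator (fun w => ENNReal.ofReal (reflectedKernel d k α p x w)) w) +
      ∫⁻ w in {w | ‖x.snd‖ < ‖w.snd‖}, {w | ε * (‖w.snd‖ / ‖x.snd‖) < ‖w - x‖}.indicator
        (fun w => ENNReal.ofReal (reflectedKernel d k α p x w)) w := by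
  have ha : 0 < ‖x.snd‖ := norm_pos_iff.2 hx
  have hm1 := (measurable_residualKernel d k α p x).ennreal_ofReal
  have hm2 := (measurable_reflectedKernel d k α p x).ennreal_ofReal
  rw [← lintegral_add_left (hm1.indicator (measurableSet_far ε x)), ← lintegral_add_right _
    (hm2.indicator (measurableSet_farOuter ε ‖x.snd‖ x))]
  refine setLIntegral_congr_fun (measurableSet_outer _) fun w hw => ?_
  have hw' : ‖x.snd‖ < ‖w.snd‖ := hw
  have h1 := residualKernel_nonneg d k hk hα2 hp hx hw'
  have h2 := reflectedKernel_nonneg d k (α := α) hp hw'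
  simp only [pvKernel_eq_add d k, ENNReal.ofReal_add h1 h2, Set.indicator, shell,
    Set.mem_inter_iff, Set.mem_compl_iff, Set.mem_ofPred_eq]
  have h3 : ε * (‖w.snd‖ / ‖x.snd‖) < ‖w - x‖ → ε < ‖w - x‖ := by
    refine fun h => lt_of_le_of_lt (le_mul_of_one_le_right hε.le ?_) h
    exact (one_le_div ha).2 hw'.le
  by_cases h4 : ε * (‖w.snd‖ / ‖x.snd‖) < ‖w - x‖
  · simp [h4, h3 h4]
  · by_cases h5 : ε < ‖w - x‖ <;> simp [h4, h5]

theorem ofReal_pvKernel_eq_zero (d : ℕ) {α p : ℝ} (hp : 0 < p) {x w : WithLp 2 (U × V)}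
    (h : ‖w.snd‖ ≤ ‖x.snd‖) : ENNReal.ofReal (pvKernel d α p x w) = 0 := by
  refine ENNReal.ofReal_of_nonpos (mul_nonpos_of_nonpos_of_nonneg ?_ (by positivity))
  linarith [rpow_sub_rpow_nonneg (norm_nonneg w.snd) h hp.le]

theorem ofReal_neg_pvKernel_eq_zero (d : ℕ) {α p : ℝ} (hp : 0 < p) {x w : WithLp 2 (U × V)}
    (h : ‖x.snd‖ ≤ ‖w.snd‖) : ENNReal.ofReal (-pvKernel d α p x w) = 0 := by
  refine ENNReal.ofReal_of_nonpos (neg_nonpos.2 (mul_nonneg ?_ (by positivity)))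
  exact rpow_sub_rpow_nonneg (norm_nonneg x.snd) h hp.le

/-- The positive part lives on the outer region and the negative part on the inner one. Their common
term is finite for each `ε > 0`, so it cancels exactly before the limit. -/
theorem integral_pvKernel_eq (d k : ℕ) (hk : 2 ≤ k) {α p : ℝ} (hα2 : α < 2)
    (hp0 : 0 < p) (hpα : p < α)
    (hd : Module.finrank ℝ U + Module.finrank ℝ V = d) (hV : Module.finrank ℝ V = k)
    {x : WithLp 2 (U × V)} (hx : x.snd ≠ 0) {ε : ℝ} (hε : 0 < ε) :
    ∫ w in {w | ε < ‖w - x‖}, pvKernel d α p x w =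
      ((∫⁻ w in {w | ‖x.snd‖ < ‖w.snd‖}, {w | ε < ‖w - x‖}.indicator
        (fun w => ENNReal.ofReal (residualKernel d k α p x w)) w) +
      ∫⁻ w in {w | ‖x.snd‖ < ‖w.snd‖}, (shell x ε).indicator
        (fun w => ENNReal.ofReal (reflectedKernel d k α p x w)) w).toReal := by
  have hint := integrableOn_pvKernel d hp0 hpα (finrank_withLp_prod.trans hd) x hε
  have hpos : ∫⁻ w in {w | ε < ‖w - x‖}, ENNReal.ofReal (pvKernel d α p x w) =
      ∫⁻ w in {w | ‖x.snd‖ < ‖w.snd‖}, {w | ε < ‖w - x‖}.indicator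
        (fun w => ENNReal.ofReal (pvKernel d α p x w)) w := by
    rw [← lintegral_indicator (measurableSet_far ε x), ← lintegral_indicator (measurableSet_outer _)]
    refine lintegral_congr fun w => ?_
    by_cases h : ‖x.snd‖ < ‖w.snd‖
    · simp [Set.indicator, h]
    · simp [Set.indicator, h, ofReal_pvKernel_eq_zero d hp0 (not_lt.1 h)]
  have hneg : ∫⁻ w in {w | ε < ‖w - x‖}, ENNReal.ofReal (-pvKernel d α p x w) =
      ∫⁻ w in {w | ‖w.snd‖ < ‖x.snd‖}, {w | ε < ‖w - x‖}.indicator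
        (fun w => ENNReal.ofReal (-pvKernel d α p x w)) w := by
    rw [← lintegral_indicator (measurableSet_far ε x), ← lintegral_indicator (measurableSet_inner _)]
    refine lintegral_congr fun w => ?_
    by_cases h : ‖w.snd‖ < ‖x.snd‖
    · simp [Set.indicator, h]
    · simp [Set.indicator, h, ofReal_neg_pvKernel_eq_zero d hp0 (not_lt.1 h)]
  have hfin1 : ∫⁻ w in {w | ε < ‖w - x‖}, ENNReal.ofReal (pvKernel d α p x w) ≠ ⊤ :=
    (hint.lintegral_lt_top).ne
  have hfin2 : ∫⁻ w in {w | ε < ‖w - x‖}, ENNReal.ofReal (-pvKernel d α p x w) ≠ ⊤ :=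
    (hint.neg.lintegral_lt_top).ne
  rw [integral_eq_lintegral_pos_part_sub_lintegral_neg_part hint]
  rw [hpos, lintegral_outer_eq d k hk hα2 hp0 hx hε,
    ← lintegral_inner_eq d k hk hd hV hx ε, ← hneg] at hfin1 ⊢
  rw [ENNReal.toReal_add (ENNReal.add_ne_top.1 hfin1).1 hfin2, add_sub_cancel_right]

theorem tendsto_integral_pvKernel (d k : ℕ) (hk : 2 ≤ k) (hkd : k ≤ d) {α p : ℝ} (hα0 : 0 < α)
    (hα2 : α < 2) (hp0 : 0 < p) (hpα : p < α)
    (hU : Module.finrank ℝ U = d - k) (hV : Module.finrank ℝ V = k)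
    {x : WithLp 2 (U × V)} (hx : x.snd ≠ 0) :
    Tendsto (fun ε : ℝ => ∫ w in {w | ε < ‖w - x‖}, pvKernel d α p x w) (𝓝[>] 0)
      (𝓝 (constW d k α * (∫ s in Set.Ioi (1 : ℝ), integrandC k α p s) * ‖x.snd‖ ^ (p - α))) := by
  have hd : Module.finrank ℝ U + Module.finrank ℝ V = d := by omega
  have h := (tendsto_lintegral_residual d k hk hkd hα0 hα2 hp0 hpα hU hV hx).add
    (tendsto_lintegral_shell d k hk hkd hα0 hα2 hp0 (finrank_withLp_prod.trans hd) hx)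
  rw [add_zero] at h
  have h2 := (ENNReal.tendsto_toReal ENNReal.ofReal_ne_top).comp h
  have hnn : 0 ≤ ∫ s in Set.Ioi (1 : ℝ), integrandC k α p s :=
    setIntegral_nonneg measurableSet_Ioi fun s hs => integrandC_nonneg k hk hα2 hp0 hs
  rw [ENNReal.toReal_ofReal
    (mul_nonneg (mul_nonneg (constW_nonneg d k α) hnn) (by positivity))] at h2
  refine h2.congr' ?_
  filter_upwards [self_mem_nhdsWithin] with ε hε
  exact (integral_pvKernel_eq d k hk hα2 hp0 hpα hd hV hx hε).symm

end PrincipalValue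

/-! ### Transfer to `ℝ^d` and the concrete flat. -/

/-- The set `flat d k` as a linear subspace. -/
def flatSubmodule (d k : ℕ) : Submodule ℝ (EuclideanSpace ℝ (Fin d)) where
  carrier := flat d k
  add_mem' ha hb i hi := by simp [ha i hi, hb i hi]
  zero_mem' i _ := rfl
  smul_mem' c y hy i hi := by simp [hy i hi]

theorem finrank_flatSubmodule (d k : ℕ) (hkd : k ≤ d) :
    Module.finrank ℝ (flatSubmodule d k) = d - k := by
  let T : EuclideanSpace ℝ (Fin d) →ₗ[ℝ] ({i : Fin d // d ≤ (i : ℕ) + k} → ℝ) :=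
    { toFun := fun y i => y i
      map_add' := fun _ _ => rfl
      map_smul' := fun _ _ => rfl }
  have hker : LinearMap.ker T = flatSubmodule d k := by
    ext y
    rw [LinearMap.mem_ker]
    constructor
    · intro h i hi
      exact congrFun h ⟨i, hi⟩
    · intro h
      funext i
      exact h i.1 i.2
  have hsurj : LinearMap.range T = ⊤ := by
    rw [LinearMap.range_eq_top]
    intro f
    refine ⟨WithLp.toLp 2 fun i => if h : d ≤ (i : ℕ) + k then f ⟨i, h⟩ else 0, ?_⟩
    funext i
    change (if h : d ≤ ((i : Fin d) : ℕ) + k then f ⟨i, h⟩ else 0) = f i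
    rw [dif_pos i.2]
  have hcard : Fintype.card {i : Fin d // d ≤ (i : ℕ) + k} = k := by
    have e : {i : Fin d // d ≤ (i : ℕ) + k} ≃ Fin k :=
      -- The zero-based indices concerned are `d - k, …, d - 1`.
      { toFun := fun i => ⟨i.1 - (d - k), by have := i.2; have := i.1.2; omega⟩
        invFun := fun j => ⟨⟨j + (d - k), by omega⟩, by simp only; omega⟩
        left_inv := fun i => by
          have := i.2
          ext
          simp only
          omega
        right_inv := fun j => by
          ext
          simp }
    rw [Fintype.card_congr e, Fintype.card_fin]
  have h := LinearMap.finrank_range_add_finrank_ker T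
  rw [hker, hsurj, finrank_top, Module.finrank_fintype_fun_eq_card, hcard,
    finrank_euclideanSpace_fin] at h
  omega

theorem finrank_flatSubmodule_orthogonal (d k : ℕ) (hkd : k ≤ d) :
    Module.finrank ℝ (flatSubmodule d k)ᗮ = k := by
  have h := Submodule.finrank_add_finrank_orthogonal (flatSubmodule d k)
  rw [finrank_flatSubmodule d k hkd, finrank_euclideanSpace_fin] at h
  omega

/-- The splitting of `ℝ^d` into the directions along and orthogonal to the flat. -/
def flatDecomposition (d k : ℕ) : EuclideanSpace ℝ (Fin d) ≃ₗᵢ[ℝ]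
    WithLp 2 (flatSubmodule d k × (flatSubmodule d k)ᗮ) :=
  (flatSubmodule d k).orthogonalDecomposition

theorem delta_eq_norm_snd (d k : ℕ) (y : EuclideanSpace ℝ (Fin d)) :
    delta d k y = ‖(flatDecomposition d k y).snd‖ := by
  set J := flatDecomposition d k
  have hset : (domain d k)ᶜ = (flatSubmodule d k : Set (EuclideanSpace ℝ (Fin d))) := by
    rw [domain, compl_compl]; rfl
  rw [delta, hset]
  have hproj : ‖(J y).snd‖ = ‖y - (flatSubmodule d k).starProjection y‖ := by
    rw [← Submodule.starProjection_orthogonal_val, Submodule.starProjection_apply,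
      Submodule.coe_norm]
    simp [J, flatDecomposition, Submodule.orthogonalDecomposition_apply]
  rw [hproj, Metric.infDist_eq_iInf, (flatSubmodule d k).starProjection_minimal y]
  simp only [dist_eq_norm]
  rfl

theorem mem_domain_iff (d k : ℕ) (y : EuclideanSpace ℝ (Fin d)) :
    y ∈ domain d k ↔ (flatDecomposition d k y).snd ≠ 0 := by
  rw [← norm_pos_iff, ← delta_eq_norm_snd, delta]
  have hclosed : IsClosed (domain d k)ᶜ := by
    have h := (flatSubmodule d k).closed_of_finiteDimensional
    rwa [domain, compl_compl]
  have hne : ((domain d k)ᶜ).Nonempty := ⟨0, by rw [domain, compl_compl]; exact fun i _ => rfl⟩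
  rw [← hclosed.notMem_iff_infDist_pos hne, Set.notMem_compl_iff]

theorem volume_flat (d k : ℕ) (hk : 0 < k) (hkd : k ≤ d) : volume (flat d k) = 0 := by
  refine Measure.addHaar_submodule volume (flatSubmodule d k) fun h => ?_
  have := finrank_flatSubmodule d k hkd
  rw [h, finrank_top, finrank_euclideanSpace_fin] at this
  omega

theorem normA_pos {n : ℕ} {α : ℝ} (hα0 : 0 < α) (hα2 : α < 2) : 0 < normA n α := by
  have h1 : 0 < Real.Gamma (((n : ℝ) + α) / 2) := Real.Gamma_pos_of_pos (by positivity)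
  have h2 : 0 < Real.Gamma (1 - α / 2) := Real.Gamma_pos_of_pos (by linarith)
  unfold normA
  positivity

theorem hasPV_delta (d k : ℕ) (hk : 2 ≤ k) (hkd : k ≤ d) {α p : ℝ} (hα0 : 0 < α)
    (hα2 : α < 2) (hp0 : 0 < p) (hpα : p < α) {x : EuclideanSpace ℝ (Fin d)}
    (hx : x ∈ domain d k) :
    HasPV (domain d k) (fun y => (delta d k y ^ p - delta d k x ^ p) / ‖y - x‖ ^ ((d : ℝ) + α)) x
      (constW d k α * (∫ s in Set.Ioi (1 : ℝ), integrandC k α p s) * delta d k x ^ (p - α)) := by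
  set J := flatDecomposition d k with hJ
  have hU := finrank_flatSubmodule d k hkd
  have hV := finrank_flatSubmodule_orthogonal d k hkd
  have hfun : (fun y => (delta d k y ^ p - delta d k x ^ p) / ‖y - x‖ ^ ((d : ℝ) + α)) =
      fun y => pvKernel d α p (J x) (J y) := by
    funext y
    rw [delta_eq_norm_snd, delta_eq_norm_snd, pvKernel, ← map_sub, LinearIsometryEquiv.norm_map,
      Real.rpow_neg (norm_nonneg _), div_eq_mul_inv]
  have hpre : ∀ ε : ℝ, {y | ε < ‖y - x‖} = J ⁻¹' {w | ε < ‖w - J x‖} := by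
    intro ε
    ext y
    simp only [Set.mem_preimage, Set.mem_ofPred_eq]
    rw [← map_sub, LinearIsometryEquiv.norm_map]
  have hemb : MeasurableEmbedding J := J.toHomeomorph.measurableEmbedding
  rw [hfun, delta_eq_norm_snd]
  refine ⟨fun ε hε => ?_, ?_⟩
  · refine IntegrableOn.mono_set ?_ Set.inter_subset_right
    rw [hpre]
    exact (J.measurePreserving.integrableOn_comp_preimage hemb).2
      (integrableOn_pvKernel d hp0 hpα
        (by rw [finrank_withLp_prod, hU, hV]; omega) (J x) hε)
  · refine (tendsto_integral_pvKernel d k hk hkd hα0 hα2 hp0 hpα hU hV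
      ((mem_domain_iff d k x).1 hx)).congr fun ε => ?_
    -- The flat is a proper subspace, hence null, so the restriction to `D_k` can be dropped.
    have hae : (domain d k ∩ {y | ε < ‖y - x‖} : Set _) =ᵐ[volume] {y | ε < ‖y - x‖} := by
      have h0 : domain d k =ᵐ[volume] Set.univ := by
        rw [ae_eq_univ, domain, compl_compl]
        exact volume_flat d k (by omega) hkd
      have h1 := h0.inter (ae_eq_refl {y | ε < ‖y - x‖})
      rwa [Set.univ_inter] at h1
    rw [setIntegral_congr_set hae, hpre]
    exact (J.measurePreserving.setIntegral_preimage_emb hemb _ _).symm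

end StableHarmonic

end

theorem mainTheorem6 (d k : ℕ) (hk : 2 ≤ k) (hkd : k ≤ d) (α p : ℝ)
    (hα0 : 0 < α) (hα2 : α < 2) (hp0 : 0 < p) (hpα : p < α) :
    -- the integrals defining the constant converge
    (Integrable (StableHarmonic.integrandW d k α) ∧
      (∀ s : ℝ, 1 < s →
        IntervalIntegrable (StableHarmonic.integrandH k α s) volume 0 Real.pi) ∧
      IntegrableOn (StableHarmonic.integrandC k α p) (Set.Ioi 1)) ∧
    -- the principal value exists and the identity holds
    ∀ x ∈ StableHarmonic.domain d k, ∃ L : ℝ,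
      StableHarmonic.HasPV (StableHarmonic.domain d k)
        (fun y => (StableHarmonic.delta d k y ^ p - StableHarmonic.delta d k x ^ p) /
          ‖y - x‖ ^ ((d : ℝ) + α)) x L ∧
      StableHarmonic.normA d α * L
          - StableHarmonic.constC d k α p * StableHarmonic.delta d k x ^ (p - α) = 0 := by
  refine ⟨⟨StableHarmonic.integrable_integrandW d k hα0, fun s hs =>
    (StableHarmonic.continuous_integrandH k α hs).intervalIntegrable 0 Real.pi,
    StableHarmonic.integrableOn_integrandC k hk hα0 hα2 hp0 hpα⟩, fun x hx =>
    ⟨_, StableHarmonic.hasPV_delta d k hk hkd hα0 hα2 hp0 hpα hx, ?_⟩⟩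
  -- The factor `normA k α` in `constCtilde` cancels the denominator in `constC`.
  have hA := (StableHarmonic.normA_pos (n := k) hα0 hα2).ne'
  rw [StableHarmonic.constC, StableHarmonic.constCtilde]
  field_simp
  ring
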